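/- Let $M$ be a closed (compact, without boundary) oriented smooth three-manifold and let $\kappa>0$ be a real number. A three-dimensional Heterotic soliton on $M$ is a triple $(g,\varphi,f)$ consisting of a smooth Riemannian metric $g$, a smooth closed one-form $\varphi$ and a smooth function $f$ on $M$ such that $$-\kappa\,\mathrm{Ric}^g\circ_g\mathrm{Ric}^g+\Big(1+\kappa s_g-\frac{\kappa}{2}f^2\Big)\mathrm{Ric}^g+\Big(\kappa|\mathrm{Ric}^g|_g^2-\frac{\kappa}{2}s_g^2+\frac{\kappa}{4}|\mathrm{d}f|_g^2-\frac12 f^2+\frac{\kappa}{8}f^4\Big)g+\frac{\kappa}{2}[\ast_g\mathrm{d}f,\mathrm{Ric}^g]+\frac{\kappa}{4}\,\mathrm{d}f\otimes\mathrm{d}f+\nabla^g\varphi=0,$$ $$f\varphi=\mathrm{d}f,\qquad s_g=3\,\delta^g\varphi+2|\varphi|_g^2-\frac12 f^2 .$$ Here $\mathrm{Ric}^g$ and $s_g$ are the Ricci and scalar curvatures of $g$, $\nabla^g$ is its Levi-Civita connection, $\delta^g\varphi=-\mathrm{Tr}_g\nabla^g\varphi$, $(\mathrm{Ric}^g\circ_g\mathrm{Ric}^g)(v,w)=g(\mathrm{Ric}^g(v),\mathrm{Ric}^g(w))$,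 and $[\cdot,\cdot]$ is the commutator of bilinear forms regarded as endomorphisms of $TM$ by means of $g$ (a form $\tau$ corresponding to the endomorphism $T$ with $g(Tv,w)=\tau(v,w)$). Put $H=f\nu_g$, where $\nu_g$ is the Riemannian volume form, so that $f=\ast_g H$. The soliton is called trivial if $\varphi=0$ and $H=0$ identically on $M$ and $g$ is flat. Then a three-dimensional Heterotic soliton $(g,\varphi,f)$ on $M$ is trivial if and only if $f=0$ identically on $M$. -/

import Mathlib

open Set Filter Topology Manifold Bundle
open scoped ContDiff Matrix

noncomputable section

namespace Heterotic

/-- The model space `ℝ³`. -/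
abbrev E3 : Type := EuclideanSpace ℝ (Fin 3)

/-- The given atlas is oriented: every transition map between two of its charts has positive
Jacobian determinant. A manifold with such an atlas is an oriented three-manifold, and its charts
are the positively oriented ones. -/
def OrientedAtlas (M : Type*) [TopologicalSpace M] [ChartedSpace E3 M] : Prop :=
  ∀ e ∈ atlas E3 M, ∀ e' ∈ atlas E3 M, ∀ y ∈ (e.symm.trans e').source,
    0 < (fderiv ℝ (e.symm.trans e') y).det

section Geometry

variable {M : Type*} [TopologicalSpace M] [ChartedSpace E3 M] [IsManifold (𝓡 3) ∞ M]

/-- Smooth Riemannian metrics on `M`. -/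
abbrev RiemMetric (M : Type*) [TopologicalSpace M] [ChartedSpace E3 M] [IsManifold (𝓡 3) ∞ M] :=
  ContMDiffRiemannianMetric (𝓡 3) ∞ E3 (fun p : M ↦ TangentSpace (𝓡 3) p)

/-- (Not necessarily continuous) one-forms on `M`. -/
abbrev OneForm (M : Type*) [TopologicalSpace M] [ChartedSpace E3 M] :=
  (p : M) → TangentSpace (𝓡 3) p →L[ℝ] ℝ

/-- (Not necessarily continuous) three-forms on `M`. -/
abbrev ThreeForm (M : Type*) [TopologicalSpace M] [ChartedSpace E3 M] :=
  (p : M) → TangentSpace (𝓡 3) p [⋀^Fin 3]→ₗ[ℝ] ℝ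

/-- Smoothness of a one-form, as a section of the cotangent bundle. -/
def OneForm.IsSmooth (α : OneForm M) : Prop :=
  ContMDiff (𝓡 3) ((𝓡 3).prod 𝓘(ℝ, E3 →L[ℝ] ℝ)) ∞
    (fun p ↦ TotalSpace.mk' (E3 →L[ℝ] ℝ) (E := fun p : M ↦ TangentSpace (𝓡 3) p →L[ℝ] ℝ) p (α p))

/-- The differential of a function. -/
def differential (f : M → ℝ) : OneForm M :=
  fun p ↦ mfderiv (𝓡 3) 𝓘(ℝ, ℝ) f p

/-- The basis of `T_pM` given by the coordinate vectors at `p` of the preferred chart at `p`;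
in Mathlib `T_pM` is identified with `ℝ³` through that chart. -/
def chartBasis (p : M) : Module.Basis (Fin 3) ℝ (TangentSpace (𝓡 3) p) :=
  (EuclideanSpace.basisFun (Fin 3) ℝ).toBasis

/-- The Riemannian volume form `ν_g = √(det g_{ij}) dx¹ ∧ dx² ∧ dx³` of an oriented
three-manifold, written at `p` in the (positively oriented) preferred chart at `p`. -/
def volumeForm (g : RiemMetric M) : ThreeForm M :=
  fun p ↦ √(Matrix.of fun i j ↦ g.inner p (chartBasis p i) (chartBasis p j)).det •
    (chartBasis p).det

/-! ### Local coordinates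

In the following, `c : M` stands for the preferred chart `extChartAt (𝓡 3) c` at `c`, with
coordinates `x¹, x², x³`, and `y` for a point of its target. -/

/-- The point of `M` with coordinates `y`. -/
def pt (c : M) (y : E3) : M := (extChartAt (𝓡 3) c).symm y

/-- The coordinate vector field `∂_i`, at the point with coordinates `y`. -/
def coordVec (c : M) (y : E3) (i : Fin 3) : TangentSpace (𝓡 3) (pt c y) :=
  mfderiv 𝓘(ℝ, E3) (𝓡 3) (extChartAt (𝓡 3) c).symm y (EuclideanSpace.single i (1 : ℝ) : E3)

/-- The partial derivative `∂_i F`. -/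
def pderiv (i : Fin 3) (F : E3 → ℝ) (y : E3) : ℝ :=
  fderiv ℝ F y (EuclideanSpace.single i (1 : ℝ))

/-- The components `α_i = α(∂_i)` of a one-form. -/
def comp (α : OneForm M) (c : M) (y : E3) (i : Fin 3) : ℝ :=
  α (pt c y) (coordVec c y i)

/-- The components `g_{ij} = g(∂_i, ∂_j)` of the metric. -/
def gram (g : RiemMetric M) (c : M) (y : E3) : Matrix (Fin 3) (Fin 3) ℝ :=
  Matrix.of fun i j ↦ g.inner (pt c y) (coordVec c y i) (coordVec c y j)

/-- The Christoffel symbols `Γ^k_{ij}` of the Levi-Civita connection: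
`Γ^k_{ij} = ½ g^{kl} (∂_i g_{jl} + ∂_j g_{il} - ∂_l g_{ij})`. -/
def christoffel (g : RiemMetric M) (c : M) (k i j : Fin 3) (y : E3) : ℝ :=
  1 / 2 * ∑ l, (gram g c y)⁻¹ k l *
    (pderiv i (fun z ↦ gram g c z j l) y + pderiv j (fun z ↦ gram g c z i l) y
      - pderiv l (fun z ↦ gram g c z i j) y)

/-- The components `R^l_{kij}` of the Riemann curvature tensor, `R_{∂_i,∂_j} ∂_k = R^l_{kij} ∂_l`
with the convention `R_{u,v} w = ∇_u ∇_v w - ∇_v ∇_u w - ∇_{[u,v]} w`. -/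
def riemann (g : RiemMetric M) (c : M) (y : E3) (l k i j : Fin 3) : ℝ :=
  pderiv i (christoffel g c l j k) y - pderiv j (christoffel g c l i k) y
    + ∑ m, (christoffel g c l i m y * christoffel g c m j k y
      - christoffel g c l j m y * christoffel g c m i k y)

/-- The Ricci tensor, `Ric(v, w) = Tr (u ↦ R_{u,v} w)`. -/
def ricci (g : RiemMetric M) (c : M) (y : E3) : Matrix (Fin 3) (Fin 3) ℝ :=
  Matrix.of fun j k ↦ ∑ i, riemann g c y i k i j

/-- The scalar curvature `s_g = g^{ij} Ric_{ij}`. -/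
def scalarCurvature (g : RiemMetric M) (c : M) (y : E3) : ℝ :=
  ∑ i, ∑ j, (gram g c y)⁻¹ i j * ricci g c y i j

/-- The tensor `(Ric ∘_g Ric)(v, w) = g(Ric v, Ric w)`. -/
def ricciSq (g : RiemMetric M) (c : M) (y : E3) : Matrix (Fin 3) (Fin 3) ℝ :=
  ricci g c y * (gram g c y)⁻¹ * (ricci g c y)ᵀ

/-- The squared norm `|Ric|²_g = g^{ij} g^{kl} Ric_{ik} Ric_{jl}`. -/
def ricciNormSq (g : RiemMetric M) (c : M) (y : E3) : ℝ :=
  ∑ i, ∑ j, ∑ k, ∑ l, (gram g c y)⁻¹ i j * (gram g c y)⁻¹ k l * ricci g c y i k * ricci g c y j l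

/-- The squared norm `|α|²_g = g^{ij} α_i α_j` of a one-form. -/
def normSq (g : RiemMetric M) (α : OneForm M) (c : M) (y : E3) : ℝ :=
  ∑ i, ∑ j, (gram g c y)⁻¹ i j * comp α c y i * comp α c y j

/-- The covariant derivative `(∇^g α)_{ij} = (∇_{∂_i} α)(∂_j) = ∂_i α_j - Γ^k_{ij} α_k`. -/
def nabla (g : RiemMetric M) (α : OneForm M) (c : M) (y : E3) : Matrix (Fin 3) (Fin 3) ℝ :=
  Matrix.of fun i j ↦ pderiv i (fun z ↦ comp α c z j) y - ∑ k, christoffel g c k i j y * comp α c y k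

/-- The codifferential `δ^g α = - g^{ij} (∇^g α)_{ij}`. -/
def codiff (g : RiemMetric M) (α : OneForm M) (c : M) (y : E3) : ℝ :=
  - ∑ i, ∑ j, (gram g c y)⁻¹ i j * nabla g α c y i j

/-- The Hodge dual `*_g α = α^♯ ⌟ ν_g`, a two-form. -/
def hodge (g : RiemMetric M) (α : OneForm M) (c : M) (y : E3) : Matrix (Fin 3) (Fin 3) ℝ :=
  Matrix.of fun i j ↦ ∑ k, (∑ l, (gram g c y)⁻¹ k l * comp α c y l) *
    volumeForm g (pt c y) ![coordVec c y k, coordVec c y i, coordVec c y j]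

/-- A bilinear form `τ` regarded as the endomorphism `τ^♯` with `g(τ^♯ v, w) = τ(v, w)`; its matrix
acts on the column of components of `v`. -/
def toEnd (g : RiemMetric M) (c : M) (y : E3) (τ : Matrix (Fin 3) (Fin 3) ℝ) :
    Matrix (Fin 3) (Fin 3) ℝ :=
  (gram g c y)⁻¹ * τᵀ

/-- The commutator `[σ, τ]` of two bilinear forms regarded as endomorphisms, regarded in turn as
the bilinear form `(v, w) ↦ g([σ^♯, τ^♯] v, w)`. -/
def formCommutator (g : RiemMetric M) (c : M) (y : E3) (σ τ : Matrix (Fin 3) (Fin 3) ℝ) :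
    Matrix (Fin 3) (Fin 3) ℝ :=
  (toEnd g c y σ * toEnd g c y τ - toEnd g c y τ * toEnd g c y σ)ᵀ * gram g c y

/-- The one-form `α` is closed: `∂_i α_j = ∂_j α_i` in coordinates. -/
def OneForm.IsClosed (α : OneForm M) : Prop :=
  ∀ c : M, ∀ y ∈ (extChartAt (𝓡 3) c).target, ∀ i j : Fin 3,
    pderiv i (fun z ↦ comp α c z j) y = pderiv j (fun z ↦ comp α c z i) y

/-- The left-hand side of the Einstein equation of the three-dimensional Heterotic soliton system:
`- κ Ric ∘ Ric + (1 + κ s - κ f²/2) Ric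
  + (κ |Ric|² - κ s²/2 + κ |df|²/4 - f²/2 + κ f⁴/8) g + κ/2 [*df, Ric] + κ/4 df ⊗ df + ∇φ`. -/
def einstein (κ : ℝ) (g : RiemMetric M) (φ : OneForm M) (f : M → ℝ) (c : M) (y : E3) :
    Matrix (Fin 3) (Fin 3) ℝ :=
  -(κ • ricciSq g c y)
    + (1 + κ * scalarCurvature g c y - κ / 2 * f (pt c y) ^ 2) • ricci g c y
    + (κ * ricciNormSq g c y - κ / 2 * scalarCurvature g c y ^ 2 + κ / 4 * normSq g (differential f) c y
        - 1 / 2 * f (pt c y) ^ 2 + κ / 8 * f (pt c y) ^ 4) • gram g c y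
    + (κ / 2) • formCommutator g c y (hodge g (differential f) c y) (ricci g c y)
    + (κ / 4) • Matrix.vecMulVec (comp (differential f) c y) (comp (differential f) c y)
    + nabla g φ c y

/-- `(g, φ, f)` is a three-dimensional Heterotic soliton with parameter `κ`: `g` is a smooth
Riemannian metric, `φ` a smooth closed one-form, `f` a smooth function, and they satisfy the
three-dimensional Heterotic soliton system. -/
structure IsSoliton (κ : ℝ) (g : RiemMetric M) (φ : OneForm M) (f : M → ℝ) : Prop where
  smooth_form : φ.IsSmooth
  smooth_fun : ContMDiff (𝓡 3) 𝓘(ℝ, ℝ) ∞ f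
  closed : φ.IsClosed
  einstein_eq : ∀ c : M, ∀ y ∈ (extChartAt (𝓡 3) c).target, einstein κ g φ f c y = 0
  maxwell_eq : ∀ (p : M) (v : TangentSpace (𝓡 3) p), f p * φ p v = differential f p v
  dilaton_eq : ∀ c : M, ∀ y ∈ (extChartAt (𝓡 3) c).target,
    scalarCurvature g c y = 3 * codiff g φ c y + 2 * normSq g φ c y - 1 / 2 * f (pt c y) ^ 2

/-- The three-form `H = f ν_g`, so that `f = *_g H`. -/
def flux (g : RiemMetric M) (f : M → ℝ) : ThreeForm M :=
  fun p ↦ f p • volumeForm g p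

/-- The metric `g` is flat: its Riemann curvature tensor vanishes. -/
def IsFlat (g : RiemMetric M) : Prop :=
  ∀ c : M, ∀ y ∈ (extChartAt (𝓡 3) c).target, ∀ l k i j : Fin 3, riemann g c y l k i j = 0

/-- The triple `(g, φ, f)` is trivial: `φ` and `H = f ν_g` vanish identically and `g` is flat. -/
def IsTrivial (g : RiemMetric M) (φ : OneForm M) (f : M → ℝ) : Prop :=
  (∀ p, φ p = 0) ∧ (∀ p, flux g f p = 0) ∧ IsFlat g

end Geometry

end Heterotic

end

set_option linter.unusedSectionVars false

/-! The substance is the implication from `f = 0`. The trace of the Einstein equation then reads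
`2κ|Ric|² + s - κs²/2 - δφ = 0` (`trace_einstein`), and eliminating the linear term in `s` with the
dilaton equation `s = 3δφ + 2|φ|²` gives `δφ + |φ|² = κ(s²/4 - |Ric|²)`. In dimension three `s² ≤
3|Ric|²` (`scalarCurvature_sq_le`), so the right-hand side is nonpositive. A codifferential
integrates to zero on a closed manifold, hence `∫|φ|² ≤ 0` and `φ = 0` (`eq_zero_of_codiff_le`). The
dilaton equation now gives `s = 0`, the trace equation `|Ric|² = 0`, and a Ricci-flat metric in
dimension three is flat (`isFlat_of_ricci_eq_zero`).

The divergence theorem is proved in coordinates. In one chart it is the identity `∂_k(√g α^k) = -√g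
δα` (`sum_pderiv_sharpDensity`) together with the vanishing of integrals of derivatives of compactly
supported functions; a partition of unity and the change of variables formula make it global
(`sum_setIntegral_codiff`). Flatness is linear algebra: the two skew-symmetries of the curvature
reduce it to a 3×3 matrix, which the Ricci tensor determines (`adjugate_mul_mul_adjugate`).

Conversely, a volume form vanishes nowhere, so `H = 0` forces `f = 0`. -/

noncomputable section

namespace Heterotic

/-! ### Charts, components of tensors, and their transformation laws -/

section Charts

variable {M : Type*} [TopologicalSpace M] [ChartedSpace E3 M] [IsManifold (𝓡 3) ∞ M]

/-- The range of the coordinates of the chart at `c`. -/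
abbrev dom (c : M) : Set E3 := (extChartAt (𝓡 3) c).target

lemma isOpen_dom (c : M) : IsOpen (dom c) := isOpen_extChartAt_target c

lemma pt_mem_source {c : M} {y : E3} (hy : y ∈ dom c) : pt c y ∈ (extChartAt (𝓡 3) c).source :=
  (extChartAt (𝓡 3) c).map_target hy

lemma extChartAt_pt {c : M} {y : E3} (hy : y ∈ dom c) : extChartAt (𝓡 3) c (pt c y) = y :=
  (extChartAt (𝓡 3) c).right_inv hy

lemma pt_extChartAt {c p : M} (hp : p ∈ (extChartAt (𝓡 3) c).source) :
    pt c (extChartAt (𝓡 3) c p) = p :=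
  (extChartAt (𝓡 3) c).left_inv hp

lemma contMDiffOn_pt (c : M) : ContMDiffOn 𝓘(ℝ, E3) (𝓡 3) ∞ (pt c) (dom c) :=
  contMDiffOn_extChartAt_symm c

lemma mdifferentiableAt_pt {c : M} {y : E3} (hy : y ∈ dom c) :
    MDifferentiableAt 𝓘(ℝ, E3) (𝓡 3) (pt c) y :=
  ((contMDiffOn_pt c).contMDiffAt ((isOpen_dom c).mem_nhds hy)).mdifferentiableAt (by simp)

lemma mdifferentiableAt_coord {c p : M} (hp : p ∈ (extChartAt (𝓡 3) c).source) :
    MDifferentiableAt (𝓡 3) 𝓘(ℝ, E3) (extChartAt (𝓡 3) c) p := by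
  rw [extChartAt_source] at hp
  exact mdifferentiableAt_extChartAt hp

/-- The coordinate field is the image of a constant field on `ℝ³` under the tangent map of `pt c`,
and tangent maps of smooth maps are smooth. -/
lemma contMDiffOn_coordVec (c : M) (i : Fin 3) :
    ContMDiffOn 𝓘(ℝ, E3) ((𝓡 3).prod 𝓘(ℝ, E3)) ∞
      (fun y ↦ TotalSpace.mk' E3 (E := fun p : M ↦ TangentSpace (𝓡 3) p) (pt c y) (coordVec c y i))
      (dom c) := by
  have h := (contMDiffOn_pt c).contMDiffOn_tangentMapWithin (m := ∞) (by simp)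
    (isOpen_dom c).uniqueMDiffOn
  have hs : ContMDiff 𝓘(ℝ, E3) (𝓘(ℝ, E3).prod 𝓘(ℝ, E3)) ∞
      (fun y : E3 ↦ TotalSpace.mk' E3 (E := fun p : E3 ↦ TangentSpace 𝓘(ℝ, E3) p) y
        (EuclideanSpace.single i (1 : ℝ) : E3)) := by
    intro y
    refine contMDiffAt_totalSpace.2 ⟨contMDiffAt_id, ?_⟩
    simp only [trivializationAt_model_space_apply]
    exact contMDiffAt_const
  refine (h.comp hs.contMDiffOn (fun y hy ↦ hy)).congr fun y hy ↦ ?_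
  simp only [Function.comp, tangentMapWithin]
  rw [mfderivWithin_of_isOpen (isOpen_dom c) hy]
  rfl

lemma contDiffOn_gram (g : RiemMetric M) (c : M) (i j : Fin 3) :
    ContDiffOn ℝ ∞ (fun y ↦ gram g c y i j) (dom c) := by
  rw [← contMDiffOn_iff_contDiffOn]
  have : ContMDiffOn 𝓘(ℝ, E3) ((𝓡 3).prod 𝓘(ℝ)) ∞
      (fun y ↦ TotalSpace.mk' ℝ (E := Bundle.Trivial M ℝ) (pt c y)
        (g.inner (pt c y) (coordVec c y i) (coordVec c y j))) (dom c) := by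
    apply ContMDiffOn.clm_bundle_apply₂ (F₁ := E3) (F₂ := E3)
    · exact g.contMDiff.comp_contMDiffOn (contMDiffOn_pt c)
    · exact contMDiffOn_coordVec c i
    · exact contMDiffOn_coordVec c j
  intro y hy
  exact (contMDiffWithinAt_totalSpace.1 (this y hy)).2

lemma contDiffOn_comp {α : OneForm M} (hα : α.IsSmooth) (c : M) (i : Fin 3) :
    ContDiffOn ℝ ∞ (fun y ↦ comp α c y i) (dom c) := by
  rw [← contMDiffOn_iff_contDiffOn]
  have : ContMDiffOn 𝓘(ℝ, E3) ((𝓡 3).prod 𝓘(ℝ)) ∞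
      (fun y ↦ TotalSpace.mk' ℝ (E := Bundle.Trivial M ℝ) (pt c y)
        (α (pt c y) (coordVec c y i))) (dom c) := by
    apply ContMDiffOn.clm_bundle_apply (F₁ := E3) (F₂ := ℝ) (E₁ := fun p : M ↦ TangentSpace (𝓡 3) p)
      (E₂ := Bundle.Trivial M ℝ) (ϕ := fun y ↦ α (pt c y))
    · exact hα.comp_contMDiffOn (contMDiffOn_pt c)
    · exact contMDiffOn_coordVec c i
  intro y hy
  exact (contMDiffWithinAt_totalSpace.1 (this y hy)).2

lemma contDiffOn_comp_pt {ρ : M → ℝ} (hρ : ContMDiff (𝓡 3) 𝓘(ℝ, ℝ) ∞ ρ) (c : M) :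
    ContDiffOn ℝ ∞ (fun y ↦ ρ (pt c y)) (dom c) := by
  rw [← contMDiffOn_iff_contDiffOn]
  exact hρ.comp_contMDiffOn (contMDiffOn_pt c)

lemma comp_differential {ρ : M → ℝ} (hρ : ContMDiff (𝓡 3) 𝓘(ℝ, ℝ) ∞ ρ) {c : M} {y : E3}
    (hy : y ∈ dom c) (i : Fin 3) :
    comp (differential ρ) c y i = pderiv i (fun z ↦ ρ (pt c z)) y := by
  have h := mfderiv_comp y (hρ.mdifferentiableAt (x := pt c y) (by simp)) (mdifferentiableAt_pt hy)
  have h' := congrArg (fun L ↦ L (EuclideanSpace.single i (1 : ℝ) : E3)) h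
  rw [mfderiv_eq_fderiv] at h'
  exact h'.symm

/-- The differential of `pt c` at `y`, as a linear map of `ℝ³`. -/
def frame (c : M) (y : E3) : E3 →L[ℝ] E3 := mfderiv 𝓘(ℝ, E3) (𝓡 3) (pt c) y

/-- The chain rule applied to chart ∘ `pt c` = id provides a left inverse. -/
lemma frame_injective {c : M} {y : E3} (hy : y ∈ dom c) : Function.Injective (frame c y) := by
  have h := mfderiv_comp y (mdifferentiableAt_coord (pt_mem_source hy)) (mdifferentiableAt_pt hy)
  have hid : (extChartAt (𝓡 3) c ∘ pt c) =ᶠ[𝓝 y] id := by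
    filter_upwards [(isOpen_dom c).mem_nhds hy] with z hz using extChartAt_pt hz
  rw [hid.mfderiv_eq, mfderiv_id] at h
  intro v w hvw
  have hv := congrArg (fun L ↦ L (v : E3)) h
  have hw := congrArg (fun L ↦ L (w : E3)) h
  have : v = mfderiv (𝓡 3) 𝓘(ℝ, E3) (extChartAt (𝓡 3) c) (pt c y) (frame c y v) := hv
  rw [this, hvw]
  exact hw.symm

lemma sum_smul_single (v : E3) : v = ∑ i, v i • (EuclideanSpace.single i (1 : ℝ) : E3) := by
  ext j
  simp [Fin.sum_univ_three]
  fin_cases j <;> simp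

lemma posDef_gram (g : RiemMetric M) {c : M} {y : E3} (hy : y ∈ dom c) : (gram g c y).PosDef := by
  refine Matrix.PosDef.of_dotProduct_mulVec_pos ?_ ?_
  · ext i j
    simp only [Matrix.conjTranspose_apply, star_trivial, gram, Matrix.of_apply]
    exact g.symm _ _ _
  · intro x hx
    have hv : (WithLp.toLp 2 x : E3) ≠ 0 := by simpa using hx
    have hne : (frame c y (WithLp.toLp 2 x) : TangentSpace (𝓡 3) (pt c y)) ≠ 0 := by
      intro h
      exact hv (frame_injective hy (h.trans (map_zero (frame c y)).symm))
    have hpos := g.pos (pt c y) _ hne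
    have hs : (frame c y (WithLp.toLp 2 x) : TangentSpace (𝓡 3) (pt c y))
        = ∑ i, x i • coordVec c y i := by
      conv_lhs => rw [sum_smul_single (WithLp.toLp 2 x)]
      rw [map_sum]
      simp only [map_smul]
      rfl
    rw [hs] at hpos
    simp only [map_sum, map_smul, sum_apply, smul_apply,
      smul_eq_mul] at hpos
    refine hpos.trans_eq ?_
    simp only [dotProduct, Matrix.mulVec, gram, Matrix.of_apply, star_trivial, Finset.mul_sum]
    refine Finset.sum_congr rfl fun i _ ↦ Finset.sum_congr rfl fun j _ ↦ ?_
    rw [g.symm]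
    ring

/-- All tangent spaces are the same `ℝ³` by definition, but their types depend on the base point.
This lemma and the next move the base point along an equality while leaving the vectors alone. -/
lemma inner_congr (g : RiemMetric M) {p q : M} (h : p = q) (v w : E3) :
    g.inner p (v : TangentSpace (𝓡 3) p) (w : TangentSpace (𝓡 3) p)
      = g.inner q (v : TangentSpace (𝓡 3) q) (w : TangentSpace (𝓡 3) q) := by
  subst h; rfl

lemma oneForm_congr (α : OneForm M) {p q : M} (h : p = q) (v : E3) :
    α p (v : TangentSpace (𝓡 3) p) = α q (v : TangentSpace (𝓡 3) q) := by
  subst h; rfl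

/-- The change of coordinates from the chart at `c` to the chart at `c'`. -/
def trans (c c' : M) (y : E3) : E3 := extChartAt (𝓡 3) c' (pt c y)

/-- The coordinates, in the chart at `c`, of the overlap with the chart at `c'`. -/
def overlap (c c' : M) : Set E3 := dom c ∩ pt c ⁻¹' (extChartAt (𝓡 3) c').source

lemma isOpen_overlap (c c' : M) : IsOpen (overlap c c') :=
  (contMDiffOn_pt c).continuousOn.isOpen_inter_preimage (isOpen_dom c)
    (isOpen_extChartAt_source c')

lemma trans_mem_overlap {c c' : M} {y : E3} (hy : y ∈ overlap c c') :
    trans c c' y ∈ overlap c' c := by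
  refine ⟨(extChartAt (𝓡 3) c').map_source hy.2, ?_⟩
  have : pt c' (trans c c' y) = pt c y := pt_extChartAt hy.2
  rw [mem_preimage, this]
  exact pt_mem_source hy.1

lemma pt_trans {c c' : M} {y : E3} (hy : y ∈ overlap c c') : pt c' (trans c c' y) = pt c y :=
  pt_extChartAt hy.2

lemma trans_trans {c c' : M} {y : E3} (hy : y ∈ overlap c c') :
    trans c' c (trans c c' y) = y := by
  rw [trans, pt_trans hy, extChartAt_pt hy.1]

lemma image_trans (c c' : M) : trans c c' '' overlap c c' = overlap c' c := by
  ext z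
  constructor
  · rintro ⟨y, hy, rfl⟩
    exact trans_mem_overlap hy
  · intro hz
    exact ⟨trans c' c z, trans_mem_overlap hz, trans_trans hz⟩

lemma injOn_trans (c c' : M) : InjOn (trans c c') (overlap c c') := by
  intro y hy z hz h
  rw [← trans_trans hy, h, trans_trans hz]

lemma mdifferentiableAt_trans {c c' : M} {y : E3} (hy : y ∈ overlap c c') :
    MDifferentiableAt 𝓘(ℝ, E3) 𝓘(ℝ, E3) (trans c c') y :=
  (mdifferentiableAt_coord hy.2).comp y (mdifferentiableAt_pt hy.1)

lemma differentiableAt_trans {c c' : M} {y : E3} (hy : y ∈ overlap c c') :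
    DifferentiableAt ℝ (trans c c') y :=
  (mdifferentiableAt_trans hy).differentiableAt

lemma frame_trans {c c' : M} {y : E3} (hy : y ∈ overlap c c') (v : E3) :
    frame c y v = frame c' (trans c c' y) (fderiv ℝ (trans c c') y v) := by
  have h := mfderiv_comp y (mdifferentiableAt_pt (trans_mem_overlap hy).1)
    (mdifferentiableAt_trans hy)
  have hid : (pt c' ∘ trans c c') =ᶠ[𝓝 y] pt c := by
    filter_upwards [(isOpen_overlap c c').mem_nhds hy] with z hz using pt_trans hz
  rw [mfderiv_eq_fderiv] at h
  have h2 := hid.mfderiv_eq (I := 𝓘(ℝ, E3)) (I' := 𝓡 3)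
  have h3 := congrArg (fun L : E3 →L[ℝ] E3 ↦ L v) h
  have h4 := congrArg (fun L : E3 →L[ℝ] E3 ↦ L v) h2
  exact h4.symm.trans h3

/-- The Jacobian matrix of the change of coordinates. -/
def jacobian (c c' : M) (y : E3) : Matrix (Fin 3) (Fin 3) ℝ :=
  LinearMap.toMatrix (EuclideanSpace.basisFun (Fin 3) ℝ).toBasis
    (EuclideanSpace.basisFun (Fin 3) ℝ).toBasis (fderiv ℝ (trans c c') y : E3 →ₗ[ℝ] E3)

lemma det_jacobian (c c' : M) (y : E3) :
    (jacobian c c' y).det = (fderiv ℝ (trans c c') y).det :=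
  LinearMap.det_toMatrix _ _

lemma jacobian_apply (c c' : M) (y : E3) (i j : Fin 3) :
    jacobian c c' y i j = (fderiv ℝ (trans c c') y (EuclideanSpace.single j (1 : ℝ))) i := by
  simp [jacobian, LinearMap.toMatrix_apply]

lemma coordVec_trans {c c' : M} {y : E3} (hy : y ∈ overlap c c') (i : Fin 3) :
    (coordVec c y i : E3) = ∑ j, jacobian c c' y j i • (coordVec c' (trans c c' y) j : E3) := by
  have h := frame_trans hy (EuclideanSpace.single i (1 : ℝ))
  rw [sum_smul_single (fderiv ℝ (trans c c') y (EuclideanSpace.single i (1 : ℝ))), map_sum] at h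
  simp only [map_smul, ← jacobian_apply] at h
  exact h

lemma gram_trans (g : RiemMetric M) {c c' : M} {y : E3} (hy : y ∈ overlap c c') :
    gram g c y = (jacobian c c' y)ᵀ * gram g c' (trans c c' y) * jacobian c c' y := by
  ext i j
  have h : gram g c y i j = g.inner (pt c' (trans c c' y))
      (∑ k, jacobian c c' y k i • coordVec c' (trans c c' y) k)
      (∑ k, jacobian c c' y k j • coordVec c' (trans c c' y) k) := by
    have h0 := inner_congr g (pt_trans hy).symm (coordVec c y i) (coordVec c y j)
    rw [← coordVec_trans hy i, ← coordVec_trans hy j]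
    exact h0
  rw [h]
  simp only [map_sum, map_smul, sum_apply, smul_apply,
      smul_eq_mul, Matrix.mul_apply, Matrix.transpose_apply, gram, Matrix.of_apply,
      Finset.sum_mul, Finset.mul_sum]
  refine Finset.sum_congr rfl fun a _ ↦ Finset.sum_congr rfl fun b _ ↦ ?_
  ring

lemma comp_trans (α : OneForm M) {c c' : M} {y : E3} (hy : y ∈ overlap c c') :
    comp α c y = (jacobian c c' y)ᵀ *ᵥ comp α c' (trans c c' y) := by
  ext i
  have h : comp α c y i = α (pt c' (trans c c' y))
      (∑ k, jacobian c c' y k i • coordVec c' (trans c c' y) k) := by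
    have h0 := oneForm_congr α (pt_trans hy).symm (coordVec c y i)
    rw [← coordVec_trans hy i]
    exact h0
  rw [h]
  simp only [map_sum, map_smul, smul_eq_mul, Matrix.mulVec, dotProduct, Matrix.transpose_apply, comp]

/-- The density `√(det g_{ij})`. -/
def density (g : RiemMetric M) (c : M) (y : E3) : ℝ := √(gram g c y).det

/-- The inner product `g^{ij} α_i β_j` of one-forms. -/
def cometric (g : RiemMetric M) (α β : OneForm M) (c : M) (y : E3) : ℝ :=
  comp α c y ⬝ᵥ (gram g c y)⁻¹ *ᵥ comp β c y

lemma det_gram_pos (g : RiemMetric M) {c : M} {y : E3} (hy : y ∈ dom c) :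
    0 < (gram g c y).det := (posDef_gram g hy).det_pos

lemma density_pos (g : RiemMetric M) {c : M} {y : E3} (hy : y ∈ dom c) : 0 < density g c y :=
  Real.sqrt_pos.2 (det_gram_pos g hy)

/-- The factor `|det|` is the one in the change of variables formula, so density times Lebesgue
measure does not depend on the chart. -/
lemma density_trans (g : RiemMetric M) {c c' : M} {y : E3} (hy : y ∈ overlap c c') :
    density g c y = |(fderiv ℝ (trans c c') y).det| * density g c' (trans c c' y) := by
  have : (gram g c y).det
      = (fderiv ℝ (trans c c') y).det ^ 2 * (gram g c' (trans c c' y)).det := by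
    rw [gram_trans g hy, Matrix.det_mul, Matrix.det_mul, Matrix.det_transpose, det_jacobian]
    ring
  rw [density, this, Real.sqrt_mul (sq_nonneg _), Real.sqrt_sq_eq_abs, density]

lemma isUnit_det_jacobian (g : RiemMetric M) {c c' : M} {y : E3} (hy : y ∈ overlap c c') :
    IsUnit (jacobian c c' y).det := by
  rw [isUnit_iff_ne_zero]
  intro h
  have := det_gram_pos g hy.1
  rw [gram_trans g hy, Matrix.det_mul, h, mul_zero] at this
  exact this.false

lemma cometric_trans (g : RiemMetric M) (α β : OneForm M) {c c' : M} {y : E3}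
    (hy : y ∈ overlap c c') : cometric g α β c y = cometric g α β c' (trans c c' y) := by
  have hJ := isUnit_det_jacobian g hy
  have hJt : IsUnit (jacobian c c' y)ᵀ.det := by rwa [Matrix.det_transpose]
  rw [cometric, comp_trans α hy, comp_trans β hy, gram_trans g hy, Matrix.mul_inv_rev,
    Matrix.mul_inv_rev, Matrix.mulVec_transpose, ← Matrix.dotProduct_mulVec, Matrix.mulVec_mulVec,
    Matrix.mulVec_mulVec]
  simp only [Matrix.mul_assoc]
  rw [Matrix.nonsing_inv_mul _ hJt, Matrix.mul_one, Matrix.mul_nonsing_inv_cancel_left _ _ hJ]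
  rfl

lemma cometric_self (g : RiemMetric M) (α : OneForm M) (c : M) (y : E3) :
    cometric g α α c y = normSq g α c y := by
  simp only [cometric, normSq, dotProduct, Matrix.mulVec, Finset.mul_sum]
  refine Finset.sum_congr rfl fun i _ ↦ Finset.sum_congr rfl fun j _ ↦ ?_
  ring

lemma normSq_nonneg (g : RiemMetric M) (α : OneForm M) {c : M} {y : E3} (hy : y ∈ dom c) :
    0 ≤ normSq g α c y := by
  rw [← cometric_self]
  simpa [cometric] using (posDef_gram g hy).inv.posSemidef.dotProduct_mulVec_nonneg (comp α c y)

lemma comp_eq_zero_of_normSq (g : RiemMetric M) (α : OneForm M) {c : M} {y : E3} (hy : y ∈ dom c)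
    (h : normSq g α c y = 0) : comp α c y = 0 := by
  by_contra hne
  have := (posDef_gram g hy).inv.dotProduct_mulVec_pos hne
  rw [← cometric_self, cometric] at h
  simp [h] at this

/-- A one-form whose components vanish at a point vanishes there. -/
lemma eq_zero_of_comp (α : OneForm M) {p : M}
    (h : comp α p (extChartAt (𝓡 3) p p) = 0) : α p = 0 := by
  set y := extChartAt (𝓡 3) p p
  have hy : y ∈ dom p := mem_extChartAt_target p
  have hp : pt p y = p := extChartAt_to_inv p
  have hz : ∀ w : E3, α (pt p y) (frame p y w : TangentSpace (𝓡 3) (pt p y)) = 0 := by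
    intro w
    rw [sum_smul_single w, map_sum]
    have : ∀ i, α (pt p y) (coordVec p y i) = 0 := fun i ↦ congrFun h i
    simp only [map_smul]
    refine (map_sum (α (pt p y)) (fun i ↦ w i • coordVec p y i) Finset.univ).trans ?_
    simp [this]
  have hs : Function.Surjective (frame p y) :=
    LinearMap.surjective_of_injective (f := (frame p y : E3 →ₗ[ℝ] E3)) (frame_injective hy)
  ext v
  obtain ⟨w, hw⟩ := hs v
  have := hz w
  rw [hw] at this
  exact (oneForm_congr α hp.symm v).trans this

end Charts

/-! ### Calculus in one chart: the coordinate formula for the divergence -/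

section LocalCalculus

variable {M : Type*} [TopologicalSpace M] [ChartedSpace E3 M] [IsManifold (𝓡 3) ∞ M]

lemma pderiv_add (i : Fin 3) {F G : E3 → ℝ} {y : E3} (hF : DifferentiableAt ℝ F y)
    (hG : DifferentiableAt ℝ G y) :
    pderiv i (fun z ↦ F z + G z) y = pderiv i F y + pderiv i G y := by
  simp [pderiv, fderiv_fun_add hF hG]

lemma pderiv_mul (i : Fin 3) {F G : E3 → ℝ} {y : E3} (hF : DifferentiableAt ℝ F y)
    (hG : DifferentiableAt ℝ G y) :
    pderiv i (fun z ↦ F z * G z) y = pderiv i F y * G y + F y * pderiv i G y := by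
  simp [pderiv, fderiv_fun_mul hF hG]
  ring

lemma pderiv_sum {ι : Type*} (s : Finset ι) (i : Fin 3) {F : ι → E3 → ℝ} {y : E3}
    (hF : ∀ j ∈ s, DifferentiableAt ℝ (F j) y) :
    pderiv i (fun z ↦ ∑ j ∈ s, F j z) y = ∑ j ∈ s, pderiv i (F j) y := by
  simp [pderiv, fderiv_fun_sum hF]

lemma pderiv_congr (i : Fin 3) {F G : E3 → ℝ} {y : E3} (h : F =ᶠ[𝓝 y] G) :
    pderiv i F y = pderiv i G y := by
  rw [pderiv, h.fderiv_eq, pderiv]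

lemma contDiffOn_pderiv (i : Fin 3) {F : E3 → ℝ} {U : Set E3} (hU : IsOpen U)
    (hF : ContDiffOn ℝ ∞ F U) : ContDiffOn ℝ ∞ (pderiv i F) U :=
  (hF.fderiv_of_isOpen hU (m := ∞) (by simp)).clm_apply contDiffOn_const

lemma pderiv_comm (i j : Fin 3) {F : E3 → ℝ} {y : E3} (hF : ContDiffAt ℝ ∞ F y) :
    pderiv i (pderiv j F) y = pderiv j (pderiv i F) y := by
  have hd : DifferentiableAt ℝ (fderiv ℝ F) y :=
    (hF.fderiv_right (m := 1) (by rw [one_add_one_eq_two]; exact ENat.LEInfty.out)).differentiableAt (by simp)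
  have h := hF.isSymmSndFDerivAt (by simpa using ENat.LEInfty.out)
  have hp : ∀ a b : Fin 3, pderiv a (pderiv b F) y
      = fderiv ℝ (fderiv ℝ F) y (EuclideanSpace.single a 1) (EuclideanSpace.single b 1) := by
    intro a b
    have : pderiv b F = fun z ↦ fderiv ℝ F z (EuclideanSpace.single b (1 : ℝ)) := rfl
    rw [pderiv, this, fderiv_clm_apply hd (by fun_prop)]
    simp
  rw [hp, hp, h.eq]

/-- The entrywise partial derivative of a matrix-valued function. -/
def mpderiv (i : Fin 3) (A : E3 → Matrix (Fin 3) (Fin 3) ℝ) (y : E3) :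
    Matrix (Fin 3) (Fin 3) ℝ :=
  Matrix.of fun a b ↦ pderiv i (fun z ↦ A z a b) y

lemma mpderiv_mul (i : Fin 3) {A B : E3 → Matrix (Fin 3) (Fin 3) ℝ} {y : E3}
    (hA : ∀ a b, DifferentiableAt ℝ (fun z ↦ A z a b) y)
    (hB : ∀ a b, DifferentiableAt ℝ (fun z ↦ B z a b) y) :
    mpderiv i (fun z ↦ A z * B z) y = mpderiv i A y * B y + A y * mpderiv i B y := by
  ext a b
  simp only [mpderiv, Matrix.mul_apply, Matrix.of_apply, Matrix.add_apply]
  rw [pderiv_sum _ _ (F := fun j z ↦ A z a j * B z j b) fun j _ ↦ (hA a j).mul (hB j b), ← Finset.sum_add_distrib]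
  exact Finset.sum_congr rfl fun j _ ↦ pderiv_mul i (hA a j) (hB j b)

lemma mpderiv_congr (i : Fin 3) {A B : E3 → Matrix (Fin 3) (Fin 3) ℝ} {y : E3}
    (h : A =ᶠ[𝓝 y] B) : mpderiv i A y = mpderiv i B y := by
  ext a b
  exact pderiv_congr i (h.mono fun z hz ↦ congrFun (congrFun hz a) b)

lemma _root_.ContDiffOn.differentiableAt_of_isOpen {F : E3 → ℝ} {U : Set E3} {y : E3}
    (hF : ContDiffOn ℝ ∞ F U) (hU : IsOpen U) (hy : y ∈ U) : DifferentiableAt ℝ F y :=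
  (hF.contDiffAt (hU.mem_nhds hy)).differentiableAt (by simp)

section Metric

variable (g : RiemMetric M) (c : M)

lemma gram_symm (y : E3) (i j : Fin 3) : gram g c y i j = gram g c y j i :=
  g.symm _ _ _

lemma gram_transpose (y : E3) : (gram g c y)ᵀ = gram g c y := by
  ext i j
  exact gram_symm g c y j i

lemma inv_gram_symm (y : E3) (i j : Fin 3) : (gram g c y)⁻¹ i j = (gram g c y)⁻¹ j i := by
  conv_rhs => rw [← gram_transpose g c y, ← Matrix.transpose_nonsing_inv, Matrix.transpose_apply]

lemma contDiffOn_det_gram : ContDiffOn ℝ ∞ (fun y ↦ (gram g c y).det) (dom c) := by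
  simp only [Matrix.det_apply]
  refine ContDiffOn.sum fun σ _ ↦ ContDiffOn.const_smul _ ?_
  exact contDiffOn_prod fun i _ ↦ contDiffOn_gram g c _ _

lemma contDiffOn_density : ContDiffOn ℝ ∞ (density g c) (dom c) :=
  (contDiffOn_det_gram g c).sqrt fun _ hy ↦ (det_gram_pos g hy).ne'

lemma contDiffOn_inv_gram (i j : Fin 3) :
    ContDiffOn ℝ ∞ (fun y ↦ (gram g c y)⁻¹ i j) (dom c) := by
  have hadj : ContDiffOn ℝ ∞ (fun y ↦ (gram g c y).adjugate i j) (dom c) := by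
    simp only [Matrix.adjugate_fin_three]
    have h := contDiffOn_gram g c
    fin_cases i <;> fin_cases j <;>
      simp only [Fin.zero_eta, Fin.mk_one, Fin.reduceFinMk, Matrix.of_apply, Matrix.cons_val] <;>
      first
        | exact (((h _ _).mul (h _ _)).sub ((h _ _).mul (h _ _)))
        | exact (((h _ _).mul (h _ _)).neg.add ((h _ _).mul (h _ _)))
  refine ((contDiffOn_det_gram g c).inv fun y hy ↦ (det_gram_pos g hy).ne').mul hadj |>.congr ?_
  intro y hy
  simp [Matrix.inv_def]

lemma contDiffOn_christoffel (k i j : Fin 3) :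
    ContDiffOn ℝ ∞ (christoffel g c k i j) (dom c) := by
  have h := fun a b d ↦ contDiffOn_pderiv d (isOpen_dom c) (contDiffOn_gram g c a b)
  refine contDiffOn_const.mul (ContDiffOn.sum fun l _ ↦ (contDiffOn_inv_gram g c k l).mul ?_)
  exact ((h _ _ _).add (h _ _ _)).sub (h _ _ _)

lemma contDiffOn_codiff {α : OneForm M} (hα : α.IsSmooth) :
    ContDiffOn ℝ ∞ (codiff g α c) (dom c) := by
  refine ContDiffOn.neg (ContDiffOn.sum fun i _ ↦ ContDiffOn.sum fun j _ ↦
    (contDiffOn_inv_gram g c i j).mul (ContDiffOn.sub ?_ (ContDiffOn.sum fun k _ ↦ ?_)))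
  · exact contDiffOn_pderiv i (isOpen_dom c) (contDiffOn_comp hα c j)
  · exact (contDiffOn_christoffel g c k i j).mul (contDiffOn_comp hα c k)

variable {c} {y : E3} (hy : y ∈ dom c)
include hy

/-- Differentiate `G⁻¹ G = 1`. -/
lemma mpderiv_inv_gram (i : Fin 3) :
    mpderiv i (fun z ↦ (gram g c z)⁻¹) y
      = -((gram g c y)⁻¹ * mpderiv i (gram g c) y * (gram g c y)⁻¹) := by
  have hu : ∀ z ∈ dom c, IsUnit (gram g c z).det := fun z hz ↦
    isUnit_iff_ne_zero.2 (det_gram_pos g hz).ne'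
  have h := mpderiv_mul i (y := y)
    (fun a b ↦ (contDiffOn_inv_gram g c a b).differentiableAt_of_isOpen (isOpen_dom c) hy)
    (fun a b ↦ (contDiffOn_gram g c a b).differentiableAt_of_isOpen (isOpen_dom c) hy)
  have h1 : mpderiv i (fun z ↦ (gram g c z)⁻¹ * gram g c z) y = 0 := by
    rw [mpderiv_congr i (B := fun _ ↦ 1)]
    · ext a b
      simp [mpderiv, pderiv]
    · filter_upwards [(isOpen_dom c).mem_nhds hy] with z hz
      exact Matrix.nonsing_inv_mul _ (hu z hz)
  rw [h1] at h
  have h2 := congrArg (· * (gram g c y)⁻¹) h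
  simp only [Matrix.zero_mul, Matrix.add_mul] at h2
  rw [Matrix.mul_nonsing_inv_cancel_right _ _ (hu y hy)] at h2
  exact eq_neg_of_add_eq_zero_left h2.symm

/-- Jacobi's formula, checked on the explicit 3×3 expansion after replacing `det G • G⁻¹` by the
adjugate. -/
lemma pderiv_det_gram (i : Fin 3) :
    pderiv i (fun z ↦ (gram g c z).det) y
      = (gram g c y).det * ((gram g c y)⁻¹ * mpderiv i (gram g c) y).trace := by
  have hG : ∀ a b, DifferentiableAt ℝ (fun z ↦ gram g c z a b) y := fun a b ↦
    (contDiffOn_gram g c a b).differentiableAt_of_isOpen (isOpen_dom c) hy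
  have hdet := (det_gram_pos g hy).ne'
  have hadj : (gram g c y).det * ((gram g c y)⁻¹ * mpderiv i (gram g c) y).trace
      = ((gram g c y).adjugate * mpderiv i (gram g c) y).trace := by
    rw [Matrix.inv_def, Matrix.smul_mul, Matrix.trace_smul, Ring.inverse_eq_inv', smul_eq_mul,
      mul_inv_cancel_left₀ hdet]
  rw [hadj]
  have hF : ∀ a b, HasFDerivAt (fun z ↦ gram g c z a b) (fderiv ℝ (fun z ↦ gram g c z a b) y) y :=
    fun a b ↦ (hG a b).hasFDerivAt
  have h3 := fun a b d e p q ↦ ((hF a b).mul (hF d e)).mul (hF p q)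
  have key := ((((((h3 0 0 1 1 2 2).sub (h3 0 0 1 2 2 1)).sub (h3 0 1 1 0 2 2)).add
    (h3 0 1 1 2 2 0)).add (h3 0 2 1 0 2 1)).sub (h3 0 2 1 1 2 0)).fderiv
  simp only [Matrix.det_fin_three]
  rw [pderiv]
  have e := congrArg (fun L : E3 →L[ℝ] ℝ ↦ L (EuclideanSpace.single i (1 : ℝ))) key
  refine Eq.trans e ?_
  simp only [add_apply, sub_apply, smul_apply, smul_eq_mul, Matrix.trace_fin_three,
    Matrix.mul_apply, Fin.sum_univ_three, Matrix.adjugate_fin_three, mpderiv, pderiv,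
    Matrix.of_apply, Matrix.cons_val, Pi.mul_apply]
  ring

lemma pderiv_density (i : Fin 3) :
    pderiv i (density g c) y
      = 1 / 2 * density g c y * ((gram g c y)⁻¹ * mpderiv i (gram g c) y).trace := by
  have hdet := det_gram_pos g hy
  have hd : DifferentiableAt ℝ (fun z ↦ (gram g c z).det) y :=
    (contDiffOn_det_gram g c).differentiableAt_of_isOpen (isOpen_dom c) hy
  have h := (hd.hasFDerivAt.sqrt hdet.ne').fderiv
  have e := congrArg (fun L : E3 →L[ℝ] ℝ ↦ L (EuclideanSpace.single i (1 : ℝ))) h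
  have e' : pderiv i (density g c) y
      = 1 / (2 * √(gram g c y).det) * pderiv i (fun z ↦ (gram g c z).det) y := e
  rw [e', pderiv_det_gram g hy, density]
  have hs := Real.sq_sqrt hdet.le
  have hp := Real.sqrt_pos.2 hdet
  field_simp
  rw [hs]

end Metric

/-- The contracted Christoffel symbols, in terms of the derivatives `D` of the metric and of its
inverse `H`. -/
lemma contracted_christoffel (H : Matrix (Fin 3) (Fin 3) ℝ) (D : Fin 3 → Fin 3 → Fin 3 → ℝ)
    (hH : ∀ i j, H i j = H j i) (hD : ∀ k i j, D k i j = D k j i) (m : Fin 3) :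
    ∑ k, (1 / 2 * (∑ a, ∑ b, H a b * D k b a) * H k m - ∑ b, (∑ a, H k a * D k a b) * H b m)
      = -∑ k, ∑ j, H k j * (1 / 2 * ∑ l, H m l * (D k j l + D j k l - D l k j)) := by
  have e1 : ∑ k, ∑ b, (∑ a, H k a * D k a b) * H b m = ∑ k, ∑ j, H k j * ∑ l, H m l * D k j l := by
    refine Finset.sum_congr rfl fun k _ ↦ ?_
    simp only [Finset.sum_mul, Finset.mul_sum]
    rw [Finset.sum_comm]
    refine Finset.sum_congr rfl fun j _ ↦ Finset.sum_congr rfl fun l _ ↦ ?_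
    rw [hH l m]; ring
  -- Exchanging `k` and `j` identifies the first two terms of the Christoffel symbol, so that
  -- together they absorb the factor `1/2`.
  have e2 : ∑ k, ∑ j, H k j * ∑ l, H m l * D j k l = ∑ k, ∑ j, H k j * ∑ l, H m l * D k j l := by
    rw [Finset.sum_comm]
    refine Finset.sum_congr rfl fun j _ ↦ Finset.sum_congr rfl fun l _ ↦ ?_
    rw [hH]
  have e3 : ∑ k, (∑ a, ∑ b, H a b * D k b a) * H k m
      = ∑ k, ∑ j, H k j * ∑ l, H m l * D l k j := by
    simp only [Finset.sum_mul, Finset.mul_sum]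
    rw [Finset.sum_comm]
    refine Finset.sum_congr rfl fun k _ ↦ ?_
    rw [Finset.sum_comm]
    refine Finset.sum_congr rfl fun j _ ↦ Finset.sum_congr rfl fun l _ ↦ ?_
    rw [hH l m, hD l j k]; ring
  have e4 : ∑ k, ∑ j, H k j * (1 / 2 * ∑ l, H m l * (D k j l + D j k l - D l k j))
      = 1 / 2 * (∑ k, ∑ j, H k j * ∑ l, H m l * D k j l + ∑ k, ∑ j, H k j * ∑ l, H m l * D j k l
        - ∑ k, ∑ j, H k j * ∑ l, H m l * D l k j) := by
    simp only [← Finset.sum_add_distrib, ← Finset.sum_sub_distrib, ← mul_add, ← mul_sub,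
      Finset.mul_sum]
    refine Finset.sum_congr rfl fun k _ ↦ Finset.sum_congr rfl fun j _ ↦ Finset.sum_congr rfl
      fun l _ ↦ ?_
    ring
  rw [Finset.sum_sub_distrib, e1, e4, e2, ← e3]
  simp only [mul_assoc, ← Finset.mul_sum]
  ring

/-- The component of `√(det g) α^♯` in the direction of `∂_k`. -/
def sharpDensity (g : RiemMetric M) (α : OneForm M) (c : M) (k : Fin 3) (y : E3) : ℝ :=
  density g c y * ∑ j, (gram g c y)⁻¹ k j * comp α c y j

lemma contDiffOn_sharpDensity (g : RiemMetric M) {α : OneForm M} (hα : α.IsSmooth) (c : M)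
    (k : Fin 3) : ContDiffOn ℝ ∞ (sharpDensity g α c k) (dom c) :=
  (contDiffOn_density g c).mul (ContDiffOn.sum fun j _ ↦
    (contDiffOn_inv_gram g c k j).mul (contDiffOn_comp hα c j))

lemma sum_inv_gram_christoffel (g : RiemMetric M) (c : M) (y : E3) (m : Fin 3) :
    ∑ k, (1 / 2 * ((gram g c y)⁻¹ * mpderiv k (gram g c) y).trace * (gram g c y)⁻¹ k m
        - ((gram g c y)⁻¹ * mpderiv k (gram g c) y * (gram g c y)⁻¹) k m)
      = -∑ k, ∑ j, (gram g c y)⁻¹ k j * christoffel g c m k j y := by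
  have hc := contracted_christoffel (gram g c y)⁻¹ (fun k a b ↦ mpderiv k (gram g c) y a b)
    (inv_gram_symm g c y)
    (fun k a b ↦ by simp only [mpderiv, Matrix.of_apply, gram_symm g c _ a b]) m
  refine Eq.trans ?_ hc
  simp only [Matrix.trace, Matrix.diag, Matrix.mul_apply]

lemma pderiv_sharpDensity (g : RiemMetric M) {α : OneForm M} (hα : α.IsSmooth) {c : M} {y : E3}
    (hy : y ∈ dom c) (k : Fin 3) :
    pderiv k (sharpDensity g α c k) y = density g c y *
      (∑ j, (1 / 2 * ((gram g c y)⁻¹ * mpderiv k (gram g c) y).trace * (gram g c y)⁻¹ k j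
          - ((gram g c y)⁻¹ * mpderiv k (gram g c) y * (gram g c y)⁻¹) k j) * comp α c y j
        + ∑ j, (gram g c y)⁻¹ k j * pderiv k (fun z ↦ comp α c z j) y) := by
  have hd := (contDiffOn_density g c).differentiableAt_of_isOpen (isOpen_dom c) hy
  have hH := fun a b ↦ (contDiffOn_inv_gram g c a b).differentiableAt_of_isOpen (isOpen_dom c) hy
  have hC := fun a ↦ (contDiffOn_comp hα c a).differentiableAt_of_isOpen (isOpen_dom c) hy
  have hdH : ∀ a b, pderiv k (fun z ↦ (gram g c z)⁻¹ a b) y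
      = -((gram g c y)⁻¹ * mpderiv k (gram g c) y * (gram g c y)⁻¹) a b := fun a b ↦
    congrFun (congrFun (mpderiv_inv_gram g hy k) a) b
  unfold sharpDensity
  rw [pderiv_mul k (G := fun z ↦ ∑ j, (gram g c z)⁻¹ k j * comp α c z j) hd
      (DifferentiableAt.fun_sum fun j _ ↦ (hH k j).mul (hC j)),
    pderiv_density g hy, pderiv_sum _ _ (F := fun j z ↦ (gram g c z)⁻¹ k j * comp α c z j)
      fun j _ ↦ (hH k j).mul (hC j)]
  simp only [pderiv_mul k (hH k _) (hC _), hdH]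
  rw [← Finset.sum_add_distrib, Finset.mul_sum, Finset.mul_sum, Finset.mul_sum,
    ← Finset.sum_add_distrib]
  refine Finset.sum_congr rfl fun j _ ↦ ?_
  ring

/-- The classical formula `div X = (√g)⁻¹ ∂_k(√g X^k)` for `X = α^♯`: the derivatives of `√g` and of
`g^{kj}` combine into the contracted Christoffel symbols hidden in `δα`. -/
lemma sum_pderiv_sharpDensity (g : RiemMetric M) {α : OneForm M} (hα : α.IsSmooth) {c : M} {y : E3}
    (hy : y ∈ dom c) :
    ∑ k, pderiv k (sharpDensity g α c k) y = -(density g c y * codiff g α c y) := by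
  rw [Finset.sum_congr rfl fun k _ ↦ pderiv_sharpDensity g hα hy k, ← Finset.mul_sum,
    Finset.sum_add_distrib, Finset.sum_comm]
  simp only [← Finset.sum_mul, sum_inv_gram_christoffel]
  rw [← mul_neg, codiff, neg_neg]
  congr 1
  simp only [nabla, Matrix.of_apply, mul_sub, Finset.mul_sum, Finset.sum_sub_distrib, neg_mul,
    Finset.sum_neg_distrib, Finset.sum_mul]
  rw [neg_add_eq_sub]
  congr 1
  rw [Finset.sum_comm]
  refine Finset.sum_congr rfl fun k _ ↦ ?_
  rw [Finset.sum_comm]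
  refine Finset.sum_congr rfl fun j _ ↦ Finset.sum_congr rfl fun m _ ↦ ?_
  ring

lemma sum_pderiv_mul_sharpDensity (g : RiemMetric M) {α : OneForm M} (hα : α.IsSmooth)
    {ρ : M → ℝ} (hρ : ContMDiff (𝓡 3) 𝓘(ℝ, ℝ) ∞ ρ) {c : M} {y : E3} (hy : y ∈ dom c) :
    ∑ k, pderiv k (fun z ↦ ρ (pt c z) * sharpDensity g α c k z) y
      = cometric g (differential ρ) α c y * density g c y
        - ρ (pt c y) * codiff g α c y * density g c y := by
  have hr := (contDiffOn_comp_pt hρ c).differentiableAt_of_isOpen (isOpen_dom c) hy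
  have hs := fun k ↦ (contDiffOn_sharpDensity g hα c k).differentiableAt_of_isOpen (isOpen_dom c) hy
  simp only [pderiv_mul _ hr (hs _)]
  rw [Finset.sum_add_distrib, ← Finset.mul_sum, sum_pderiv_sharpDensity g hα hy]
  simp only [← comp_differential hρ hy]
  rw [sub_eq_add_neg]
  congr 1
  · simp only [cometric, dotProduct, Matrix.mulVec, Finset.sum_mul, sharpDensity]
    refine Finset.sum_congr rfl fun i _ ↦ ?_
    ring
  · ring

end LocalCalculus

/-! ### The divergence theorem on a closed manifold -/

section Integration

open MeasureTheory

/-- The integral of a partial derivative of a function which is smooth on an open set and vanishes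
there off a compact subset is zero. -/
lemma setIntegral_pderiv_eq_zero {U K : Set E3} (hU : IsOpen U) (hK : IsCompact K) (hKU : K ⊆ U)
    {F : E3 → ℝ} (hF : ContDiffOn ℝ ∞ F U) (h0 : ∀ y ∈ U \ K, F y = 0) (i : Fin 3) :
    IntegrableOn (pderiv i F) U ∧ ∫ y in U, pderiv i F y = 0 := by
  classical
  set V : E3 → ℝ := U.indicator F with hV
  -- The open sets `U` and `Kᶜ` cover the space. The extension `V` by zero agrees locally with `F`
  -- on the first and with `0` on the second, so it is smooth with compact support.
  have hVU : ∀ y ∈ U, V =ᶠ[𝓝 y] F := fun y hy ↦ by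
    filter_upwards [hU.mem_nhds hy] with z hz using indicator_of_mem hz F
  have hVK : ∀ y ∈ Kᶜ, V =ᶠ[𝓝 y] fun _ ↦ 0 := fun y hy ↦ by
    filter_upwards [hK.isClosed.isOpen_compl.mem_nhds hy] with z hz
    by_cases hzU : z ∈ U
    · rw [hV, indicator_of_mem hzU]
      exact h0 z ⟨hzU, hz⟩
    · exact indicator_of_notMem hzU F
  have hVs : ContDiff ℝ ∞ V := by
    rw [contDiff_iff_contDiffAt]
    intro y
    by_cases hy : y ∈ U
    · exact (hF.contDiffAt (hU.mem_nhds hy)).congr_of_eventuallyEq (hVU y hy)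
    · exact contDiffAt_const.congr_of_eventuallyEq (hVK y fun h ↦ hy (hKU h))
  have hVc : HasCompactSupport V :=
    HasCompactSupport.intro hK fun y hy ↦ (hVK y hy).eq_of_nhds
  have hdc : Continuous (pderiv i V) :=
    (hVs.continuous_fderiv (by simp)).clm_apply continuous_const
  have hds : HasCompactSupport (pderiv i V) := hVc.fderiv_apply (𝕜 := ℝ) _
  have hdi : Integrable (pderiv i V) := hdc.integrable_of_hasCompactSupport hds
  have hVi : Integrable V := hVs.continuous.integrable_of_hasCompactSupport hVc
  have hcongr : EqOn (pderiv i V) (pderiv i F) U := fun y hy ↦ pderiv_congr i (hVU y hy)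
  have hint : ∫ y, pderiv i V y = 0 := by
    -- Integration by parts against the constant function `1`.
    have h := integral_mul_fderiv_eq_neg_fderiv_mul_of_integrable (μ := volume)
      (f := fun _ : E3 ↦ (1 : ℝ)) (g := V) (v := EuclideanSpace.single i (1 : ℝ))
      (by simp) (by simp only [one_mul]; exact hdi) (by simpa using hVi) (fun _ _ ↦ differentiableAt_const _)
      (fun y _ ↦ hVs.differentiable (by simp) y)
    simpa [pderiv] using h
  refine ⟨hdi.integrableOn.congr_fun hcongr hU.measurableSet, ?_⟩
  rw [← setIntegral_congr_fun hU.measurableSet hcongr, ← hint]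
  refine setIntegral_eq_integral_of_forall_compl_eq_zero fun y hy ↦ ?_
  rw [pderiv_congr i (hVK y fun h ↦ hy (hKU h))]
  simp [pderiv]

variable {M : Type*} [TopologicalSpace M] [ChartedSpace E3 M] [IsManifold (𝓡 3) ∞ M]

section Support

variable [CompactSpace M] {ρ : M → ℝ} {c : M} (hc : tsupport ρ ⊆ (extChartAt (𝓡 3) c).source)
include hc

lemma isCompact_image_tsupport : IsCompact (extChartAt (𝓡 3) c '' tsupport ρ) :=
  (isClosed_tsupport ρ).isCompact.image_of_continuousOn ((continuousOn_extChartAt c).mono hc)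

lemma image_tsupport_subset : extChartAt (𝓡 3) c '' tsupport ρ ⊆ dom c := by
  rintro _ ⟨p, hp, rfl⟩
  exact (extChartAt (𝓡 3) c).map_source (hc hp)

omit [CompactSpace M] hc in
lemma pt_notMem_tsupport {y : E3} (hy : y ∈ dom c \ extChartAt (𝓡 3) c '' tsupport ρ) :
    pt c y ∉ tsupport ρ := fun h ↦
  hy.2 ⟨pt c y, h, extChartAt_pt hy.1⟩

lemma integrableOn_dom {F : E3 → ℝ} (hF : ContinuousOn F (dom c))
    (h0 : ∀ y ∈ dom c, pt c y ∉ tsupport ρ → F y = 0) : IntegrableOn F (dom c) := by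
  have hK := isCompact_image_tsupport hc
  refine ((hF.mono (image_tsupport_subset hc)).integrableOn_compact hK).of_forall_sdiff_eq_zero
    (isOpen_dom c).measurableSet fun y hy ↦ h0 y hy.1 (pt_notMem_tsupport hy)

end Support

lemma differential_eq_zero_of_notMem_tsupport {ρ : M → ℝ} {p : M} (hp : p ∉ tsupport ρ) :
    differential ρ p = 0 := by
  have h : ρ =ᶠ[𝓝 p] fun _ ↦ 0 := notMem_tsupport_iff_eventuallyEq.1 hp
  rw [differential, h.mfderiv_eq]
  exact mfderiv_const

lemma cometric_zero_left (g : RiemMetric M) {α : OneForm M} (β : OneForm M) {c : M} {y : E3}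
    (h : α (pt c y) = 0) : cometric g α β c y = 0 := by
  have : comp α c y = 0 := by
    ext i
    simp [comp, h]
  rw [cometric, this, zero_dotProduct]

lemma contDiffOn_comp_differential {ρ : M → ℝ} (hρ : ContMDiff (𝓡 3) 𝓘(ℝ, ℝ) ∞ ρ) (c : M)
    (i : Fin 3) : ContDiffOn ℝ ∞ (fun y ↦ comp (differential ρ) c y i) (dom c) :=
  (contDiffOn_pderiv i (isOpen_dom c) (contDiffOn_comp_pt hρ c)).congr fun _ hy ↦
    comp_differential hρ hy i

lemma contDiffOn_cometric_differential (g : RiemMetric M) {ρ : M → ℝ}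
    (hρ : ContMDiff (𝓡 3) 𝓘(ℝ, ℝ) ∞ ρ) {α : OneForm M} (hα : α.IsSmooth) (c : M) :
    ContDiffOn ℝ ∞ (cometric g (differential ρ) α c) (dom c) :=
  ContDiffOn.sum (s := Finset.univ) fun i _ ↦ (contDiffOn_comp_differential hρ c i).mul
    (ContDiffOn.sum (s := Finset.univ) fun j _ ↦
      (contDiffOn_inv_gram g c i j).mul (contDiffOn_comp hα c j))

/-- The divergence theorem for `ρ α^♯`, with `ρ` supported in a chart. -/
lemma setIntegral_codiff [CompactSpace M] (g : RiemMetric M) {α : OneForm M} (hα : α.IsSmooth)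
    {ρ : M → ℝ} (hρ : ContMDiff (𝓡 3) 𝓘(ℝ, ℝ) ∞ ρ) {c : M}
    (hc : tsupport ρ ⊆ (extChartAt (𝓡 3) c).source) :
    ∫ y in dom c, ρ (pt c y) * codiff g α c y * density g c y
      = ∫ y in dom c, cometric g (differential ρ) α c y * density g c y := by
  have hz : ∀ y ∈ dom c, pt c y ∉ tsupport ρ → ρ (pt c y) = 0 := fun y _ h ↦
    image_eq_zero_of_notMem_tsupport h
  have h := fun k ↦ setIntegral_pderiv_eq_zero (isOpen_dom c) (isCompact_image_tsupport hc)
    (image_tsupport_subset hc) ((contDiffOn_comp_pt hρ c).mul (contDiffOn_sharpDensity g hα c k))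
    (fun y hy ↦ by simp only [hz y hy.1 (pt_notMem_tsupport hy), zero_mul]) k
  have hsum := integral_finsetSum Finset.univ fun k _ ↦ (h k).1
  rw [Finset.sum_eq_zero fun k _ ↦ (h k).2,
    setIntegral_congr_fun (isOpen_dom c).measurableSet
      fun y hy ↦ sum_pderiv_mul_sharpDensity g hα hρ hy, integral_sub] at hsum
  · linarith
  · refine integrableOn_dom hc ((contDiffOn_cometric_differential g hρ hα c).mul
      (contDiffOn_density g c)).continuousOn fun y _ h ↦ ?_
    rw [cometric_zero_left g α (differential_eq_zero_of_notMem_tsupport h), zero_mul]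
  · refine integrableOn_dom hc (((contDiffOn_comp_pt hρ c).mul (contDiffOn_codiff g c hα)).mul
      (contDiffOn_density g c)).continuousOn fun y hy h ↦ ?_
    rw [hz y hy h, zero_mul, zero_mul]

/-- Change of variables between two charts. -/
lemma setIntegral_overlap (g : RiemMetric M) {c c' : M} {F F' : E3 → ℝ}
    (hF : ∀ y ∈ overlap c c', F y = F' (trans c c' y)) :
    ∫ y in overlap c c', F y * density g c y = ∫ y in overlap c' c, F' y * density g c' y := by
  rw [← image_trans c c', integral_image_eq_integral_abs_det_fderiv_smul volume
    (isOpen_overlap c c').measurableSet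
    (fun y hy ↦ (differentiableAt_trans hy).hasFDerivAt.hasFDerivWithinAt) (injOn_trans c c')]
  refine setIntegral_congr_fun (isOpen_overlap c c').measurableSet fun y hy ↦ ?_
  simp only [hF y hy, density_trans g hy, smul_eq_mul]
  ring

/-- The integrand vanishes unless the point lies in both charts: one factor forces it into the
first, the other into the second. Both integrals therefore reduce to the overlap. -/
lemma setIntegral_dom_eq (g : RiemMetric M) {α β : OneForm M} {ρ : M → ℝ} {c c' : M}
    (hα : ∀ p, p ∉ (extChartAt (𝓡 3) c).source → α p = 0)
    (hρ : ∀ p, p ∉ (extChartAt (𝓡 3) c').source → ρ p = 0) :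
    ∫ y in dom c, ρ (pt c y) * cometric g α β c y * density g c y
      = ∫ y in dom c', ρ (pt c' y) * cometric g α β c' y * density g c' y := by
  rw [setIntegral_eq_of_subset_of_forall_sdiff_eq_zero (s := overlap c c')
      (isOpen_dom c).measurableSet inter_subset_left,
    setIntegral_eq_of_subset_of_forall_sdiff_eq_zero (s := overlap c' c)
      (isOpen_dom c').measurableSet inter_subset_left]
  · refine setIntegral_overlap g (F := fun y ↦ ρ (pt c y) * cometric g α β c y)
      (F' := fun y ↦ ρ (pt c' y) * cometric g α β c' y) fun y hy ↦ ?_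
    simp only [pt_trans hy, cometric_trans g α β hy]
  · intro y hy
    rw [cometric_zero_left g β (hα _ fun h ↦ hy.2 ⟨hy.1, h⟩), mul_zero, zero_mul]
  · intro y hy
    rw [hρ _ fun h ↦ hy.2 ⟨hy.1, h⟩, zero_mul, zero_mul]

section Global

variable [CompactSpace M] {ι : Type*} (s : Finset ι) (ρ : ι → M → ℝ) (c : ι → M)
  (hρ : ∀ i ∈ s, ContMDiff (𝓡 3) 𝓘(ℝ, ℝ) ∞ (ρ i))
  (hc : ∀ i ∈ s, tsupport (ρ i) ⊆ (extChartAt (𝓡 3) (c i)).source)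
  (hsum : ∀ p, ∑ i ∈ s, ρ i p = 1)
include hρ hc hsum

/-- The differential of the constant function `∑ ρ_i = 1` is zero. -/
lemma sum_cometric_differential (g : RiemMetric M) (α : OneForm M) {a : M} {y : E3}
    (hy : y ∈ dom a) : ∑ i ∈ s, cometric g (differential (ρ i)) α a y = 0 := by
  have h : ∀ k, ∑ i ∈ s, comp (differential (ρ i)) a y k = 0 := by
    intro k
    have h1 : pderiv k (fun z ↦ ∑ i ∈ s, ρ i (pt a z)) y = 0 := by
      simp [hsum, pderiv]
    rw [pderiv_sum s k fun i hi ↦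
      (contDiffOn_comp_pt (hρ i hi) a).differentiableAt_of_isOpen (isOpen_dom a) hy] at h1
    rw [← h1]
    exact Finset.sum_congr rfl fun i hi ↦ comp_differential (hρ i hi) hy k
  simp only [cometric, dotProduct]
  rw [Finset.sum_comm]
  simp only [← Finset.sum_mul, h, zero_mul, Finset.sum_const_zero]

/-- The divergence theorem on a closed manifold, with the integral computed by means of a partition
of unity. -/
lemma sum_setIntegral_codiff (g : RiemMetric M) {α : OneForm M} (hα : α.IsSmooth) :
    ∑ i ∈ s, ∫ y in dom (c i), ρ i (pt (c i) y) * codiff g α (c i) y * density g (c i) y = 0 := by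
  set I : ι → ι → E3 → ℝ := fun i j y ↦
    ρ j (pt (c i) y) * cometric g (differential (ρ i)) α (c i) y * density g (c i) y
  set J : ι → ι → E3 → ℝ := fun i j y ↦
    ρ j (pt (c j) y) * cometric g (differential (ρ i)) α (c j) y * density g (c j) y
  have hcont : ∀ i ∈ s, ∀ j ∈ s, ∀ a, ContinuousOn (fun y ↦
      ρ j (pt a y) * cometric g (differential (ρ i)) α a y * density g a y) (dom a) :=
    fun i hi j hj a ↦ (((contDiffOn_comp_pt (hρ j hj) a).mul
      (contDiffOn_cometric_differential g (hρ i hi) hα a)).mul (contDiffOn_density g a)).continuousOn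
  have hI : ∀ i ∈ s, ∀ j ∈ s, IntegrableOn (I i j) (dom (c i)) := fun i hi j hj ↦
    integrableOn_dom (hc i hi) (hcont i hi j hj (c i)) fun y _ h ↦ by
      simp only [I, cometric_zero_left g α (differential_eq_zero_of_notMem_tsupport h), mul_zero,
        zero_mul]
  have hJ : ∀ i ∈ s, ∀ j ∈ s, IntegrableOn (J i j) (dom (c j)) := fun i hi j hj ↦
    integrableOn_dom (hc j hj) (hcont i hi j hj (c j)) fun y _ h ↦ by
      simp only [J, image_eq_zero_of_notMem_tsupport h, zero_mul]
  -- The terms `⟨dρ_i, α⟩` sum to zero over `i`, but each is integrated in its own chart. Inserting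
  -- `∑ ρ_j = 1` localizes the terms a second time, so that the one with `ρ_j` can be carried to the
  -- chart `c j`; there the sum over `i` is taken under a single integral.
  calc _ = ∑ i ∈ s, ∑ j ∈ s, ∫ y in dom (c i), I i j y := by
        refine Finset.sum_congr rfl fun i hi ↦ ?_
        rw [setIntegral_codiff g hα (hρ i hi) (hc i hi), ← integral_finsetSum s (hI i hi)]
        refine integral_congr_ae (.of_forall fun y ↦ ?_)
        simp only [I, ← Finset.sum_mul, hsum, one_mul]
    _ = ∑ i ∈ s, ∑ j ∈ s, ∫ y in dom (c j), J i j y := by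
        refine Finset.sum_congr rfl fun i hi ↦ Finset.sum_congr rfl fun j hj ↦ ?_
        exact setIntegral_dom_eq g
          (fun p hp ↦ differential_eq_zero_of_notMem_tsupport fun h ↦ hp (hc i hi h))
          (fun p hp ↦ image_eq_zero_of_notMem_tsupport fun h ↦ hp (hc j hj h))
    _ = 0 := by
        rw [Finset.sum_comm]
        refine Finset.sum_eq_zero fun j hj ↦ ?_
        rw [← integral_finsetSum s fun i hi ↦ hJ i hi j hj]
        refine setIntegral_eq_zero_of_forall_eq_zero fun y hy ↦ ?_
        simp only [J, ← Finset.sum_mul, ← Finset.mul_sum,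
          sum_cometric_differential s ρ c hρ hc hsum g α hy, mul_zero, zero_mul]

end Global

variable [T2Space M] [CompactSpace M]

/-- On a closed manifold a one-form `φ` with `δφ ≤ -|φ|²` vanishes. -/
lemma eq_zero_of_codiff_le (g : RiemMetric M) {φ : OneForm M} (hφ : φ.IsSmooth)
    (hle : ∀ c : M, ∀ y ∈ dom c, codiff g φ c y ≤ -normSq g φ c y) (p : M) : φ p = 0 := by
  classical
  obtain ⟨f, hf⟩ := SmoothPartitionOfUnity.exists_isSubordinate_chartAt_source (𝓡 3) M
  -- By compactness only finitely many members of the partition of unity are nonzero, so its sum is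
  -- a finite one.
  have hfin : {i | (Function.support (f i)).Nonempty}.Finite :=
    f.locallyFinite.finite_nonempty_of_compact
  set s := hfin.toFinset
  have hc : ∀ i ∈ s, tsupport (f i) ⊆ (extChartAt (𝓡 3) i).source := fun i _ ↦ by
    rw [extChartAt_source]; exact hf i
  have hρ : ∀ i ∈ s, ContMDiff (𝓡 3) 𝓘(ℝ, ℝ) ∞ (f i) := fun i _ ↦ (f i).contMDiff
  have hsum : ∀ q, ∑ i ∈ s, f i q = 1 := by
    intro q
    rw [← f.sum_eq_one (mem_univ q)]
    refine (finsum_eq_sum_of_support_subset _ fun i hi ↦ ?_).symm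
    simp only [s, Finite.coe_toFinset]
    exact ⟨q, hi⟩
  have hle0 : ∀ i ∈ s, ∀ y ∈ dom i, f i (pt i y) * codiff g φ i y * density g i y ≤ 0 := by
    intro i _ y hy
    have h1 := (hle i y hy).trans (neg_nonpos.2 (normSq_nonneg g φ hy))
    exact mul_nonpos_of_nonpos_of_nonneg (mul_nonpos_of_nonneg_of_nonpos (f.nonneg i _) h1)
      (density_pos g hy).le
  have h := sum_setIntegral_codiff s (fun i ↦ f i) id hρ hc hsum g hφ
  -- Nonpositive terms with zero sum all vanish. Each integrand, being continuous and of one sign,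
  -- is then zero pointwise, so `δφ = 0` and `|φ|² ≤ 0` wherever some `f i` is positive.
  have hi0 := (Finset.sum_eq_zero_iff_of_nonpos fun i hi ↦
    setIntegral_nonpos (isOpen_dom i).measurableSet (hle0 i hi)).1 h
  obtain ⟨i, hi⟩ := f.exists_pos_of_mem (mem_univ p)
  have his : i ∈ s := by
    simp only [s, Finite.mem_toFinset]
    exact ⟨p, hi.ne'⟩
  have hps : p ∈ (extChartAt (𝓡 3) i).source := by
    by_contra hn
    rw [image_eq_zero_of_notMem_tsupport fun h ↦ hn (hc i his h)] at hi
    exact hi.false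
  have hcont : ContinuousOn (fun y ↦ f i (pt i y) * codiff g φ i y * density g i y) (dom i) :=
    (((contDiffOn_comp_pt (hρ i his) i).mul (contDiffOn_codiff g i hφ)).mul
      (contDiffOn_density g i)).continuousOn
  have hint : IntegrableOn (fun y ↦ f i (pt i y) * codiff g φ i y * density g i y) (dom i) :=
    integrableOn_dom (hc i his) hcont fun y _ h ↦ by
      simp only [image_eq_zero_of_notMem_tsupport h, zero_mul]
  have hae : (fun y ↦ -(f i (pt i y) * codiff g φ i y * density g i y)) =ᵐ[volume.restrict (dom i)]
      0 := by
    refine (setIntegral_eq_zero_iff_of_nonneg_ae ?_ hint.neg).1 ?_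
    · exact (ae_restrict_iff' (isOpen_dom i).measurableSet).2
        (.of_forall fun y hy ↦ neg_nonneg.2 (hle0 i his y hy))
    · simpa [integral_neg] using hi0 i his
  have hzero := Measure.eqOn_open_of_ae_eq hae (isOpen_dom i) hcont.neg continuousOn_const
  have hcod : ∀ y ∈ dom i, 0 < f i (pt i y) → comp φ i y = 0 := by
    intro y hy hpos
    have h1 := hzero hy
    simp only [Pi.zero_apply, neg_eq_zero, mul_eq_zero, hpos.ne', (density_pos g hy).ne',
      or_false, false_or] at h1
    have h2 := hle i y hy
    have h3 := normSq_nonneg g φ hy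
    exact comp_eq_zero_of_normSq g φ hy (by linarith)
  have hy : extChartAt (𝓡 3) i p ∈ dom i := (extChartAt (𝓡 3) i).map_source hps
  have h1 := hcod _ hy (by rwa [pt_extChartAt hps])
  have hy' : extChartAt (𝓡 3) p p ∈ overlap p i :=
    ⟨mem_extChartAt_target p, by
      rw [mem_preimage, pt_extChartAt (mem_extChartAt_source p)]; exact hps⟩
  refine eq_zero_of_comp φ ?_
  rw [comp_trans φ hy', trans, pt_extChartAt (mem_extChartAt_source p), h1, Matrix.mulVec_zero]

end Integration

/-! ### Linear algebra in dimension three -/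

section LinearAlgebra

/-- In dimension three, a tensor with the antisymmetries of the curvature tensor is determined by
its Ricci contraction: here `W` is the tensor dualized in both pairs of indices and `E` is the
contraction. -/
lemma adjugate_mul_mul_adjugate (H W E : Matrix (Fin 3) (Fin 3) ℝ) (hH : ∀ i j, H i j = H j i)
    (h00 : E 0 0 = H 1 1 * W 2 2 - H 1 2 * W 2 1 - H 2 1 * W 1 2 + H 2 2 * W 1 1)
    (h01 : E 0 1 = -H 1 0 * W 2 2 + H 1 2 * W 2 0 + H 2 0 * W 1 2 - H 2 2 * W 1 0)
    (h02 : E 0 2 = H 1 0 * W 2 1 - H 1 1 * W 2 0 - H 2 0 * W 1 1 + H 2 1 * W 1 0)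
    (h10 : E 1 0 = -H 0 1 * W 2 2 + H 0 2 * W 2 1 + H 2 1 * W 0 2 - H 2 2 * W 0 1)
    (h11 : E 1 1 = H 0 0 * W 2 2 - H 0 2 * W 2 0 - H 2 0 * W 0 2 + H 2 2 * W 0 0)
    (h12 : E 1 2 = -H 0 0 * W 2 1 + H 0 1 * W 2 0 + H 2 0 * W 0 1 - H 2 1 * W 0 0)
    (h20 : E 2 0 = H 0 1 * W 1 2 - H 0 2 * W 1 1 - H 1 1 * W 0 2 + H 1 2 * W 0 1)
    (h21 : E 2 1 = -H 0 0 * W 1 2 + H 0 2 * W 1 0 + H 1 0 * W 0 2 - H 1 2 * W 0 0)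
    (h22 : E 2 2 = H 0 0 * W 1 1 - H 0 1 * W 1 0 - H 1 0 * W 0 1 + H 1 1 * W 0 0) :
    H.adjugate * W * H.adjugate
      = (1 / 2 * ∑ i, ∑ j, H i j * E i j) • H.adjugate - H.det • Eᵀ := by
  have e10 := hH 1 0
  have e20 := hH 2 0
  have e21 := hH 2 1
  ext i j
  fin_cases i <;> fin_cases j <;>
    simp only [Matrix.sub_apply, Matrix.smul_apply, Matrix.mul_apply, Matrix.adjugate_fin_three,
      Matrix.det_fin_three, Fin.sum_univ_three, Matrix.transpose_apply, Matrix.of_apply,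
      Matrix.cons_val, smul_eq_mul, Fin.zero_eta, Fin.mk_one, Fin.reduceFinMk, Fin.isValue,
      h00, h01, h02, h10, h11, h12, h20, h21, h22, e10, e20, e21] <;> ring

lemma skew_eq_zero {a : Fin 3 → Fin 3 → ℝ} (h : ∀ i j, a i j = -a j i) (h12 : a 1 2 = 0)
    (h20 : a 2 0 = 0) (h01 : a 0 1 = 0) (i j : Fin 3) : a i j = 0 := by
  have hd : ∀ i, a i i = 0 := fun i ↦ self_eq_neg.1 (h i i)
  have h21 : a 2 1 = 0 := by rw [h, h12, neg_zero]
  have h02 : a 0 2 = 0 := by rw [h, h20, neg_zero]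
  have h10 : a 1 0 = 0 := by rw [h, h01, neg_zero]
  fin_cases i <;> fin_cases j <;> first | exact hd _ | assumption

/-- With zero contraction, `adjugate_mul_mul_adjugate` says `adj H * W * adj H = 0`, and `adj H` is
invertible. Only the two skew-symmetries are needed, neither pair symmetry nor the Bianchi identity.
-/
lemma skew_skew_eq_zero {H : Matrix (Fin 3) (Fin 3) ℝ} (hH : ∀ i j, H i j = H j i)
    (hdet : H.det ≠ 0) {S : Fin 3 → Fin 3 → Fin 3 → Fin 3 → ℝ}
    (h1 : ∀ i j l k, S i j l k = -S j i l k) (h2 : ∀ i j l k, S i j l k = -S i j k l)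
    (hric : ∀ j k, ∑ i, ∑ l, H i l * S i j l k = 0) (i j l k : Fin 3) : S i j l k = 0 := by
  -- Rows and columns stand for the index pairs (1,2), (2,0), (0,1), dual to 0, 1, 2.
  let W : Matrix (Fin 3) (Fin 3) ℝ := !![S 1 2 1 2, S 1 2 2 0, S 1 2 0 1;
    S 2 0 1 2, S 2 0 2 0, S 2 0 0 1; S 0 1 1 2, S 0 1 2 0, S 0 1 0 1]
  have hd1 : ∀ i l k, S i i l k = 0 := fun i l k ↦ self_eq_neg.1 (h1 i i l k)
  have hd2 : ∀ i j l, S i j l l = 0 := fun i j l ↦ self_eq_neg.1 (h2 i j l l)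
  have hE : (Matrix.of fun j k ↦ ∑ i, ∑ l, H i l * S i j l k : Matrix (Fin 3) (Fin 3) ℝ) = 0 := by
    ext j k
    exact hric j k
  have a21 := h1 2 1
  have a02 := h1 0 2
  have a10 := h1 1 0
  have b21 := fun i j ↦ h2 i j 2 1
  have b02 := fun i j ↦ h2 i j 0 2
  have b10 := fun i j ↦ h2 i j 1 0
  have key := adjugate_mul_mul_adjugate H W (Matrix.of fun j k ↦ ∑ i, ∑ l, H i l * S i j l k) hH
  have key' := by
    refine key ?_ ?_ ?_ ?_ ?_ ?_ ?_ ?_ ?_ <;>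
    simp only [W, Matrix.of_apply, Matrix.cons_val, Fin.sum_univ_three, hd1, hd2, a21, a02, a10,
      b21, b02, b10] <;> ring
  rw [hE] at key'
  simp only [Matrix.zero_apply, mul_zero, Finset.sum_const_zero, zero_smul, Matrix.transpose_zero,
    smul_zero, sub_zero] at key'
  have hu : IsUnit H.adjugate.det := by
    rw [Matrix.det_adjugate]
    exact (isUnit_iff_ne_zero.2 hdet).pow _
  have hW : W = 0 := by
    have h := congrArg (fun X ↦ H.adjugate⁻¹ * X * H.adjugate⁻¹) key'
    simp only [Matrix.mul_zero, Matrix.zero_mul] at h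
    rw [← h, Matrix.mul_assoc H.adjugate, Matrix.nonsing_inv_mul_cancel_left _ _ hu,
      Matrix.mul_nonsing_inv_cancel_right _ _ hu]
  have hW' : ∀ a b, W a b = 0 := fun a b ↦ by rw [hW]; rfl
  refine skew_eq_zero (a := fun i j ↦ S i j l k) (fun i j ↦ h1 i j l k) ?_ ?_ ?_ i j
  · exact skew_eq_zero (h2 1 2) (hW' 0 0) (hW' 0 1) (hW' 0 2) l k
  · exact skew_eq_zero (h2 2 0) (hW' 1 0) (hW' 1 1) (hW' 1 2) l k
  · exact skew_eq_zero (h2 0 1) (hW' 2 0) (hW' 2 1) (hW' 2 2) l k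

open scoped MatrixOrder Matrix.Norms.L2Operator in
lemma exists_transpose_mul_self {H : Matrix (Fin 3) (Fin 3) ℝ} (hH : H.PosDef) :
    ∃ B : Matrix (Fin 3) (Fin 3) ℝ, H = Bᵀ * B := by
  obtain ⟨B, hB⟩ := CStarAlgebra.nonneg_iff_eq_star_mul_self.1 hH.posSemidef.nonneg
  refine ⟨B, ?_⟩
  rwa [Matrix.star_eq_conjTranspose, Matrix.conjTranspose_eq_transpose_of_trivial] at hB

/-- With `H = BᵀB`, the matrix `X = B R Bᵀ` represents `R` in a frame orthonormal for the metric
with inverse `H`; metric contractions of `R` become ordinary traces of `X`. -/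
lemma exists_trace_factorization {H : Matrix (Fin 3) (Fin 3) ℝ} (hH : H.PosDef)
    (R : Matrix (Fin 3) (Fin 3) ℝ) : ∃ X : Matrix (Fin 3) (Fin 3) ℝ, (X = 0 → R = 0) ∧
      X.trace = (H * R).trace ∧ (X * Xᵀ).trace = (H * R * H * Rᵀ).trace := by
  obtain ⟨B, hB⟩ := exists_transpose_mul_self hH
  have hu : IsUnit B.det := by
    have h := hH.det_pos
    rw [hB, Matrix.det_mul, Matrix.det_transpose] at h
    rw [isUnit_iff_ne_zero]
    rintro h0
    simp [h0] at h
  have hut : IsUnit Bᵀ.det := by rwa [Matrix.det_transpose]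
  refine ⟨B * R * Bᵀ, fun h ↦ ?_, ?_, ?_⟩
  · have h' := congrArg (fun X ↦ B⁻¹ * X * Bᵀ⁻¹) h
    simp only [Matrix.mul_zero, Matrix.zero_mul] at h'
    rw [← h', Matrix.mul_assoc B, Matrix.nonsing_inv_mul_cancel_left _ _ hu,
      Matrix.mul_nonsing_inv_cancel_right _ _ hut]
  · rw [Matrix.trace_mul_comm, hB, Matrix.mul_assoc]
  · rw [hB]
    simp only [Matrix.transpose_mul, Matrix.transpose_transpose, Matrix.mul_assoc]
    rw [Matrix.trace_mul_comm Bᵀ]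
    simp only [Matrix.mul_assoc]

/-- Cauchy–Schwarz for `X` and the identity, whose squared norm is 3. -/
lemma trace_sq_le (X : Matrix (Fin 3) (Fin 3) ℝ) : X.trace ^ 2 ≤ 3 * (X * Xᵀ).trace := by
  simp only [Matrix.trace_fin_three, Matrix.mul_apply, Fin.sum_univ_three, Matrix.transpose_apply]
  nlinarith [sq_nonneg (X 0 0 - X 1 1), sq_nonneg (X 0 0 - X 2 2), sq_nonneg (X 1 1 - X 2 2),
    sq_nonneg (X 0 1), sq_nonneg (X 0 2), sq_nonneg (X 1 0), sq_nonneg (X 1 2), sq_nonneg (X 2 0),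
    sq_nonneg (X 2 1)]

end LinearAlgebra

variable {M : Type*} [TopologicalSpace M] [ChartedSpace E3 M] [IsManifold (𝓡 3) ∞ M]

/-! ### Symmetries of the curvature; Ricci-flat implies flat -/

section Curvature

variable (g : RiemMetric M) {c : M} {y : E3}

/-- The matrix `(Γ^k_{ij})_{kj}` of the connection form in the direction of `∂_i`. -/
def connection (c : M) (i : Fin 3) (y : E3) : Matrix (Fin 3) (Fin 3) ℝ :=
  Matrix.of fun k j ↦ christoffel g c k i j y

lemma gram_mul_connection (hy : y ∈ dom c) (i a b : Fin 3) :
    (gram g c y * connection g c i y) a b = 1 / 2 * (pderiv i (fun z ↦ gram g c z b a) y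
      + pderiv b (fun z ↦ gram g c z i a) y - pderiv a (fun z ↦ gram g c z i b) y) := by
  set X : Fin 3 → ℝ := fun l ↦ pderiv i (fun z ↦ gram g c z b l) y
      + pderiv b (fun z ↦ gram g c z i l) y - pderiv l (fun z ↦ gram g c z i b) y with hX
  have h : gram g c y *ᵥ ((gram g c y)⁻¹ *ᵥ X) = X := by
    rw [Matrix.mulVec_mulVec, Matrix.mul_nonsing_inv _
      (isUnit_iff_ne_zero.2 (det_gram_pos g hy).ne'), Matrix.one_mulVec]
  have h' := congrFun h a
  change _ = 1 / 2 * X a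
  rw [← h']
  simp only [Matrix.mul_apply, Matrix.mulVec, dotProduct, connection, Matrix.of_apply,
    christoffel, Finset.mul_sum, hX]
  refine Finset.sum_congr rfl fun m _ ↦ Finset.sum_congr rfl fun l _ ↦ ?_
  ring

/-- The Levi-Civita connection is metric. -/
lemma mpderiv_gram (hy : y ∈ dom c) (i : Fin 3) :
    mpderiv i (gram g c) y
      = gram g c y * connection g c i y + (gram g c y * connection g c i y)ᵀ := by
  ext a b
  have hs : ∀ k p q, pderiv k (fun z ↦ gram g c z p q) y = pderiv k (fun z ↦ gram g c z q p) y :=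
    fun k p q ↦ by simp only [gram_symm g c _ p q]
  rw [Matrix.add_apply, Matrix.transpose_apply, gram_mul_connection g hy,
    gram_mul_connection g hy, hs i b a, mpderiv, Matrix.of_apply]
  ring

/-- The matrix of the curvature endomorphism `R_{∂_i,∂_j}`. -/
def curvature (c : M) (y : E3) (i j : Fin 3) : Matrix (Fin 3) (Fin 3) ℝ :=
  Matrix.of fun l k ↦ riemann g c y l k i j

/-- Cartan's form `dΓ + Γ ∧ Γ` of the curvature, which allows the symmetries to be derived by matrix
algebra. -/
lemma curvature_eq (c : M) (y : E3) (i j : Fin 3) :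
    curvature g c y i j = mpderiv i (connection g c j) y - mpderiv j (connection g c i) y
      + (connection g c i y * connection g c j y - connection g c j y * connection g c i y) := by
  ext l k
  simp only [curvature, riemann, mpderiv, connection, Matrix.of_apply, Matrix.add_apply,
    Matrix.sub_apply, Matrix.mul_apply, Finset.sum_sub_distrib]

lemma curvature_swap (c : M) (y : E3) (i j : Fin 3) :
    curvature g c y i j = -curvature g c y j i := by
  rw [curvature_eq, curvature_eq]
  abel

lemma mpderiv_mpderiv_gram (hy : y ∈ dom c) (i j : Fin 3) :
    mpderiv i (mpderiv j (gram g c)) y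
      = mpderiv i (gram g c) y * connection g c j y + gram g c y * mpderiv i (connection g c j) y
        + (mpderiv i (gram g c) y * connection g c j y
          + gram g c y * mpderiv i (connection g c j) y)ᵀ := by
  have hG : ∀ a b, DifferentiableAt ℝ (fun z ↦ gram g c z a b) y := fun a b ↦
    (contDiffOn_gram g c a b).differentiableAt_of_isOpen (isOpen_dom c) hy
  have hΓ : ∀ a b, DifferentiableAt ℝ (fun z ↦ connection g c j z a b) y := fun a b ↦
    (contDiffOn_christoffel g c a j b).differentiableAt_of_isOpen (isOpen_dom c) hy
  have hGΓ : ∀ a b, DifferentiableAt ℝ (fun z ↦ (gram g c z * connection g c j z) a b) y :=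
    fun a b ↦ DifferentiableAt.fun_sum (u := Finset.univ)
      (A := fun k z ↦ gram g c z a k * connection g c j z k b) fun k _ ↦ (hG a k).mul (hΓ k b)
  rw [mpderiv_congr i (B := fun z ↦ gram g c z * connection g c j z
    + (gram g c z * connection g c j z)ᵀ), ← mpderiv_mul i hG hΓ]
  · ext a b
    exact pderiv_add i (hGΓ a b) (hGΓ b a)
  · filter_upwards [(isOpen_dom c).mem_nhds hy] with z hz using mpderiv_gram g hz j

/-- The curvature endomorphisms are skew-adjoint. -/
lemma gram_mul_curvature (hy : y ∈ dom c) (i j : Fin 3) :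
    gram g c y * curvature g c y i j = -(gram g c y * curvature g c y i j)ᵀ := by
  have hcomm : mpderiv i (mpderiv j (gram g c)) y = mpderiv j (mpderiv i (gram g c)) y := by
    ext a b
    exact pderiv_comm i j ((contDiffOn_gram g c a b).contDiffAt ((isOpen_dom c).mem_nhds hy))
  rw [mpderiv_mpderiv_gram g hy, mpderiv_mpderiv_gram g hy, mpderiv_gram g hy i,
    mpderiv_gram g hy j] at hcomm
  -- The difference of the two mixed second derivatives of `G` is `G R + (G R)ᵀ`: the terms `Γ_iᵀ G
  -- Γ_j - Γ_jᵀ G Γ_i` are skew and cancel against their transposes.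
  rw [curvature_eq]
  simp only [Matrix.transpose_add, Matrix.transpose_sub, Matrix.transpose_mul, gram_transpose,
    Matrix.transpose_transpose, Matrix.mul_add, Matrix.add_mul, Matrix.mul_sub,
    Matrix.mul_assoc] at hcomm ⊢
  rw [← sub_eq_zero] at hcomm ⊢
  rw [← hcomm]
  abel

lemma isFlat_of_ricci_eq_zero (h : ∀ c : M, ∀ y ∈ dom c, ricci g c y = 0) : IsFlat g := by
  intro c y hy l k i j
  have hu := isUnit_iff_ne_zero.2 (det_gram_pos g hy).ne'
  -- `S` is the curvature with its upper index lowered by `G`; contracting with `G⁻¹` raises the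
  -- index again and yields the Ricci tensor.
  have hS := skew_skew_eq_zero (H := (gram g c y)⁻¹)
    (S := fun i j l k ↦ (gram g c y * curvature g c y i j) l k) (inv_gram_symm g c y)
    (Matrix.isUnit_nonsing_inv_det _ hu).ne_zero
    (fun i j l k ↦ by rw [curvature_swap, Matrix.mul_neg, Matrix.neg_apply])
    (fun i j l k ↦ congrFun (congrFun (gram_mul_curvature g hy i j) l) k)
    (fun j k ↦ by
      have h' : ∑ i, curvature g c y i j i k = 0 := congrFun (congrFun (h c y hy) j) k
      rw [← h']
      refine Finset.sum_congr rfl fun i _ ↦ ?_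
      rw [← Matrix.mul_apply, Matrix.nonsing_inv_mul_cancel_left _ _ hu])
  have h0 : gram g c y * curvature g c y i j = 0 := by
    ext l k
    exact hS i j l k
  have : curvature g c y i j = 0 := by
    rw [← Matrix.nonsing_inv_mul_cancel_left _ (curvature g c y i j) hu, h0, Matrix.mul_zero]
  exact congrFun (congrFun this l) k

end Curvature

/-! ### The traced soliton equations and the conclusion -/

section Soliton

variable (g : RiemMetric M)

/-- The contraction `g^{ij} τ_{ij}`. -/
def contract (c : M) (y : E3) (τ : Matrix (Fin 3) (Fin 3) ℝ) : ℝ := ((gram g c y)⁻¹ * τ).trace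

lemma contract_eq_sum (c : M) (y : E3) (τ : Matrix (Fin 3) (Fin 3) ℝ) :
    contract g c y τ = ∑ i, ∑ j, (gram g c y)⁻¹ i j * τ i j := by
  rw [contract, Matrix.trace, Finset.sum_comm]
  refine Finset.sum_congr rfl fun i _ ↦ ?_
  rw [Matrix.diag, Matrix.mul_apply]
  refine Finset.sum_congr rfl fun j _ ↦ ?_
  rw [inv_gram_symm]

lemma contract_ricci (c : M) (y : E3) : contract g c y (ricci g c y) = scalarCurvature g c y :=
  contract_eq_sum g c y _

lemma contract_nabla (α : OneForm M) (c : M) (y : E3) :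
    contract g c y (nabla g α c y) = -codiff g α c y := by
  rw [contract_eq_sum, codiff, neg_neg]

lemma contract_gram {c : M} {y : E3} (hy : y ∈ dom c) : contract g c y (gram g c y) = 3 := by
  rw [contract, Matrix.nonsing_inv_mul _ (isUnit_iff_ne_zero.2 (det_gram_pos g hy).ne')]
  simp

lemma contract_ricciSq (c : M) (y : E3) :
    contract g c y (ricciSq g c y) = ricciNormSq g c y := by
  rw [contract_eq_sum, ricciNormSq]
  refine Finset.sum_congr rfl fun i _ ↦ Finset.sum_congr rfl fun j _ ↦ ?_
  simp only [ricciSq, Matrix.mul_apply, Matrix.transpose_apply, Finset.sum_mul, Finset.mul_sum]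
  rw [Finset.sum_comm]
  refine Finset.sum_congr rfl fun k _ ↦ Finset.sum_congr rfl fun l _ ↦ ?_
  ring

lemma ricciNormSq_eq_trace (c : M) (y : E3) : ricciNormSq g c y
    = ((gram g c y)⁻¹ * ricci g c y * (gram g c y)⁻¹ * (ricci g c y)ᵀ).trace := by
  rw [← contract_ricciSq, contract, ricciSq]
  simp only [Matrix.mul_assoc]

/-- In an orthonormal frame this is `trace_sq_le`; the transpose in the norm makes symmetry of the
Ricci tensor unnecessary. -/
lemma scalarCurvature_sq_le {c : M} {y : E3} (hy : y ∈ dom c) :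
    scalarCurvature g c y ^ 2 ≤ 3 * ricciNormSq g c y := by
  obtain ⟨X, -, h1, h2⟩ := exists_trace_factorization (posDef_gram g hy).inv (ricci g c y)
  rw [← contract_ricci, contract, ← h1, ricciNormSq_eq_trace, ← h2]
  exact trace_sq_le X

lemma ricci_eq_zero_of_ricciNormSq {c : M} {y : E3} (hy : y ∈ dom c) (h : ricciNormSq g c y = 0) :
    ricci g c y = 0 := by
  obtain ⟨X, h0, -, h2⟩ := exists_trace_factorization (posDef_gram g hy).inv (ricci g c y)
  refine h0 ?_
  rw [ricciNormSq_eq_trace, ← h2] at h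
  exact Matrix.trace_mul_conjTranspose_self_eq_zero_iff.1
    (by rwa [Matrix.conjTranspose_eq_transpose_of_trivial])

variable {g} {κ : ℝ} {φ : OneForm M} {f : M → ℝ}

lemma differential_eq_zero (hf : ∀ p, f p = 0) (p : M) : differential f p = 0 := by
  obtain rfl : f = fun _ ↦ 0 := funext hf
  exact mfderiv_const

/-- The trace of the Einstein equation of a Heterotic soliton with `f = 0`. -/
lemma trace_einstein (hsol : IsSoliton κ g φ f) (hf : ∀ p, f p = 0) {c : M} {y : E3}
    (hy : y ∈ dom c) : 2 * κ * ricciNormSq g c y + scalarCurvature g c y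
      - κ / 2 * scalarCurvature g c y ^ 2 - codiff g φ c y = 0 := by
  have hcomp : comp (differential f) c y = 0 := by
    ext i
    simp [comp, differential_eq_zero hf]
  have hn : normSq g (differential f) c y = 0 := by
    simp [normSq, hcomp]
  have hh : hodge g (differential f) c y = 0 := by
    ext i j
    simp [hodge, hcomp]
  have h := congrArg (contract g c y) (hsol.einstein_eq c y hy)
  simp only [einstein, hn, hh, hcomp, hf, formCommutator, toEnd, Matrix.transpose_zero,
    Matrix.mul_zero, Matrix.zero_mul, sub_zero, smul_zero, add_zero, Matrix.zero_vecMulVec] at h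
  have hadd : ∀ σ τ, contract g c y (σ + τ) = contract g c y σ + contract g c y τ := fun σ τ ↦ by
    simp [contract, Matrix.mul_add]
  have hsmul : ∀ (a : ℝ) τ, contract g c y (a • τ) = a * contract g c y τ := fun a τ ↦ by
    simp [contract]
  have hneg : ∀ τ, contract g c y (-τ) = -contract g c y τ := fun τ ↦ by
    simp [contract]
  have h0 : contract g c y 0 = 0 := by simp [contract]
  rw [hadd, hadd, hadd, hneg, hsmul, hsmul, hsmul, contract_ricciSq, contract_ricci,
    contract_gram g hy, contract_nabla, h0] at h
  linear_combination h

lemma isTrivial_of_fun_eq_zero [T2Space M] [CompactSpace M] (hκ : 0 < κ)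
    (hsol : IsSoliton κ g φ f) (hf : ∀ p, f p = 0) : IsTrivial g φ f := by
  have hdil : ∀ c : M, ∀ y ∈ dom c,
      scalarCurvature g c y = 3 * codiff g φ c y + 2 * normSq g φ c y := fun c y hy ↦ by
    have := hsol.dilaton_eq c y hy
    rw [hf] at this
    linarith
  -- Here `δφ + |φ|² = κ(s²/4 - |Ric|²) ≤ κ(1/4 - 1/3)s² = -κs²/12 ≤ 0`.
  have hφ : ∀ p, φ p = 0 := eq_zero_of_codiff_le g hsol.smooth_form fun c y hy ↦ by
    have h1 := trace_einstein hsol hf hy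
    have h2 := hdil c y hy
    have h3 := scalarCurvature_sq_le g hy
    nlinarith [mul_le_mul_of_nonneg_left h3 hκ.le, mul_nonneg hκ.le (sq_nonneg
      (scalarCurvature g c y))]
  refine ⟨hφ, fun p ↦ by simp [flux, hf], isFlat_of_ricci_eq_zero g fun c y hy ↦ ?_⟩
  have hcomp : ∀ z, comp φ c z = 0 := fun z ↦ by
    ext i
    simp [comp, hφ]
  have hδ : codiff g φ c y = 0 := by
    simp [codiff, nabla, hcomp, pderiv]
  have hn : normSq g φ c y = 0 := by
    simp [normSq, hcomp]
  have hs : scalarCurvature g c y = 0 := by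
    rw [hdil c y hy, hδ, hn]; ring
  have h1 := trace_einstein hsol hf hy
  rw [hs, hδ] at h1
  refine ricci_eq_zero_of_ricciNormSq g hy ?_
  have h2 : κ * ricciNormSq g c y = 0 := by linarith
  exact (mul_eq_zero.1 h2).resolve_left hκ.ne'

lemma chartBasis_gram_det_pos (g : RiemMetric M) (p : M) :
    0 < (Matrix.of fun i j ↦ g.inner p (chartBasis p i) (chartBasis p j)).det := by
  refine Matrix.PosDef.det_pos (Matrix.PosDef.of_dotProduct_mulVec_pos ?_ fun x hx ↦ ?_)
  · ext i j
    simp only [Matrix.conjTranspose_apply, star_trivial, Matrix.of_apply]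
    exact g.symm _ _ _
  · have hne : ∑ i, x i • chartBasis p i ≠ 0 := fun h ↦
      hx (funext (Fintype.linearIndependent_iff.1 (chartBasis p).linearIndependent x h))
    have hpos := g.pos p _ hne
    simp only [map_sum, map_smul, sum_apply, smul_apply, smul_eq_mul] at hpos
    refine hpos.trans_eq ?_
    simp only [dotProduct, Matrix.mulVec, Matrix.of_apply, star_trivial, Finset.mul_sum]
    refine Finset.sum_congr rfl fun i _ ↦ Finset.sum_congr rfl fun j _ ↦ ?_
    rw [g.symm]
    ring

/-- Evaluated on `chartBasis p`, the form `f ν_g` equals `f √(det g_{ij})`, with a positive square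
root. -/
lemma fun_eq_zero_of_flux (h : ∀ p, flux g f p = 0) (p : M) : f p = 0 := by
  have h1 := congrArg (fun η : TangentSpace (𝓡 3) p [⋀^Fin 3]→ₗ[ℝ] ℝ ↦ η (chartBasis p)) (h p)
  simp only [flux, volumeForm, AlternatingMap.smul_apply, Module.Basis.det_self, smul_eq_mul,
    mul_one, AlternatingMap.zero_apply, mul_eq_zero] at h1
  exact h1.resolve_right (Real.sqrt_pos.2 (chartBasis_gram_det_pos g p)).ne'

end Soliton

end Heterotic

end

theorem mainTheorem8 {M : Type*} [TopologicalSpace M] [T2Space M] [CompactSpace M]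
    [ChartedSpace Heterotic.E3 M] [IsManifold (𝓡 3) ∞ M]
    (hM : Heterotic.OrientedAtlas M)
    (κ : ℝ) (hκ : 0 < κ)
    (g : Heterotic.RiemMetric M) (φ : Heterotic.OneForm M) (f : M → ℝ)
    (hsol : Heterotic.IsSoliton κ g φ f) :
    Heterotic.IsTrivial g φ f ↔ ∀ p : M, f p = 0 :=
  ⟨fun h ↦ Heterotic.fun_eq_zero_of_flux h.2.1,
    fun h ↦ Heterotic.isTrivial_of_fun_eq_zero hκ hsol h⟩
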